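/- Let $M\ge 1$, $M'=\lfloor M/2\rfloor$, and let $b_j$ ($1\le j\le M$) and $b_{\overline{2m+1}}$ ($0\le m\le M'$) be complex coupling constants. Let $G_M$ be the graph with vertices $1,\dots,M$ and $\overline{1},\overline{3},\dots,\overline{2M'+1}$, and with the following edges: $i\sim j$ if $1\le|i-j|\le 2$; $\overline{c}\sim\overline{c'}$ if $|c-c'|=2$; $j\sim\overline{c}$ if $j\in\{c-6,\,c-4,\,c-2,\,c-1,\,c,\,c+1\}$. The extended FFD (free fermions in disguise) algebra is the unital associative complex algebra with one generator $h_v$ for each vertex $v$ of $G_M$ and the relations $h_v^2=b_v^2$; $h_uh_v=-h_vh_u$ if $u\sim v$; $h_uh_v=h_vh_u$ if $u\not\sim v$; and $$A_{2m-1}C_{2m+2}=C_{2m}A_{2m+3}\qquad(1<m<M'-1),$$ where $A_{2m-1}=h_{2m}h_{2m-3}+h_{2m-2}h_{\overline{2m+1}}$ and $C_{2m}=h_{2m-3}h_{\overline{2m+3}}$. Let $S_M$ be the independence number of $G_M$, and for $1\le k\le S_M$ define the charges $$Q_M^{(k)}=\sum_{S}\ \prod_{v\in S}h_v,$$ where $S$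 runs over the independent sets of $G_M$ with exactly $k$ elements (the factors commute). Theorem. The charges commute with one another: $$[Q_M^{(k)},Q_M^{(l)}]=0\qquad\text{for all } k,l\in\{1,2,\dots,S_M\},$$ in the extended FFD algebra and in each of its representations in a unital associative complex algebra. -/

import Mathlib

namespace ExtFFD

/-- The vertices of the frustration graph with parameter `M`: the vertex `inl i` carries the label
`j = i + 1 ∈ {1, …, M}` (generator `h_j`), and the vertex `inr i` carries the overlined label
`2 i + 1` with `0 ≤ i ≤ ⌊M / 2⌋` (additional generator `hbar_{2 i + 1}`). -/
abbrev Vertex (M : ℕ) : Type := Fin M ⊕ Fin (M / 2 + 1)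

/-- Adjacency of the plain vertex `j` and the overlined vertex with (odd) label `c`:
`j ∈ {c - 6, c - 4, c - 2, c}` or `j ∈ {c - 1, c + 1}`. -/
def MixedAdj (j c : ℤ) : Prop :=
  j = c - 6 ∨ j = c - 4 ∨ j = c - 2 ∨ j = c ∨ j = c - 1 ∨ j = c + 1

/-- Adjacency of vertices. The plain generators anticommute at distance one or two, the overlined
labels `c`, `c'` are adjacent when `|c - c'| = 2`. -/
def VertexAdj {M : ℕ} : Vertex M → Vertex M → Prop
  | .inl i, .inl j => (i : ℤ) ≠ j ∧ |(i : ℤ) - j| ≤ 2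
  | .inr i, .inr j => |(2 * (i : ℤ) + 1) - (2 * (j : ℤ) + 1)| = 2
  | .inl i, .inr j => MixedAdj ((i : ℤ) + 1) (2 * (j : ℤ) + 1)
  | .inr j, .inl i => MixedAdj ((i : ℤ) + 1) (2 * (j : ℤ) + 1)

instance (j c : ℤ) : Decidable (MixedAdj j c) := by
  unfold MixedAdj; infer_instance

instance {M : ℕ} (u v : Vertex M) : Decidable (VertexAdj u v) := by
  rcases u with i | i <;> rcases v with j | j <;> unfold VertexAdj <;> infer_instance

/-- The frustration graph `G_M` of the extended FFD algebra. -/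
def frustrationGraph (M : ℕ) : SimpleGraph (Vertex M) where
  Adj := VertexAdj
  symm := ⟨by
    rintro (i | i) (j | j) h
    · exact ⟨h.1.symm, by rw [abs_sub_comm]; exact h.2⟩
    · exact h
    · exact h
    · exact (abs_sub_comm _ _).trans h⟩
  loopless := ⟨by
    rintro (i | i) h
    · exact h.1 rfl
    · simp [VertexAdj] at h⟩

instance (M : ℕ) : DecidableRel (frustrationGraph M).Adj :=
  fun u v => inferInstanceAs (Decidable (VertexAdj u v))

/-- The free generator `h_j` for `1 ≤ j ≤ M`, and `0` for any other `j`. -/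
noncomputable def freeH (M j : ℕ) : FreeAlgebra ℂ (Vertex M) :=
  if hj : 1 ≤ j ∧ j ≤ M then FreeAlgebra.ι ℂ (.inl ⟨j - 1, by omega⟩) else 0

/-- The free generator `hbar_{2 m + 1}` for `0 ≤ m ≤ ⌊M / 2⌋`, and `0` for any other `m`. -/
noncomputable def freeHbar (M m : ℕ) : FreeAlgebra ℂ (Vertex M) :=
  if hm : m ≤ M / 2 then FreeAlgebra.ι ℂ (.inr ⟨m, by omega⟩) else 0

/-- `A_{2 m - 1} = h_{2 m} h_{2 m - 3} + h_{2 m - 2} hbar_{2 m + 1}` (used for `m ≥ 2`). -/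
noncomputable def freeA (M m : ℕ) : FreeAlgebra ℂ (Vertex M) :=
  freeH M (2 * m) * freeH M (2 * m - 3) + freeH M (2 * m - 2) * freeHbar M m

/-- `C_{2 m} = h_{2 m - 3} hbar_{2 m + 3}` (used for `m ≥ 2`). -/
noncomputable def freeC (M m : ℕ) : FreeAlgebra ℂ (Vertex M) :=
  freeH M (2 * m - 3) * freeHbar M (m + 1)

/-- The defining relations of the extended FFD algebra with coupling constants `b`. -/
inductive Rel (M : ℕ) (b : Vertex M → ℂ) :
    FreeAlgebra ℂ (Vertex M) → FreeAlgebra ℂ (Vertex M) → Prop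
  /-- The square of every generator is the scalar `b_v ^ 2`. -/
  | square (v : Vertex M) :
      Rel M b (FreeAlgebra.ι ℂ v * FreeAlgebra.ι ℂ v) (algebraMap ℂ _ (b v ^ 2))
  /-- Adjacent generators anticommute. -/
  | anticomm (u v : Vertex M) (h : (frustrationGraph M).Adj u v) :
      Rel M b (FreeAlgebra.ι ℂ u * FreeAlgebra.ι ℂ v) (-(FreeAlgebra.ι ℂ v * FreeAlgebra.ι ℂ u))
  /-- Non-adjacent generators commute. -/
  | comm (u v : Vertex M) (h : ¬ (frustrationGraph M).Adj u v) :
      Rel M b (FreeAlgebra.ι ℂ u * FreeAlgebra.ι ℂ v) (FreeAlgebra.ι ℂ v * FreeAlgebra.ι ℂ u)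
  /-- `A_{2 m - 1} C_{2 m + 2} = C_{2 m} A_{2 m + 3}` for `1 < m < ⌊M / 2⌋ - 1`. -/
  | ac (m : ℕ) (h1 : 1 < m) (h2 : m + 1 < M / 2) :
      Rel M b (freeA M m * freeC M (m + 1)) (freeC M m * freeA M (m + 2))

/-- The extended FFD algebra: the unital associative complex algebra presented by the generators
`h_1, …, h_M, hbar_1, hbar_3, …, hbar_{2⌊M/2⌋+1}` and the relations `Rel`. -/
abbrev ExtendedFFDAlgebra (M : ℕ) (b : Vertex M → ℂ) : Type := RingQuot (Rel M b)

/-- The generator attached to a vertex. -/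
noncomputable def gen (M : ℕ) (b : Vertex M → ℂ) (v : Vertex M) : ExtendedFFDAlgebra M b :=
  RingQuot.mkAlgHom ℂ (Rel M b) (FreeAlgebra.ι ℂ v)

theorem gen_commute {M : ℕ} (b : Vertex M → ℂ) {u v : Vertex M}
    (h : ¬ (frustrationGraph M).Adj u v) : Commute (gen M b u) (gen M b v) := by
  have := RingQuot.mkAlgHom_rel ℂ (Rel.comm (b := b) u v h)
  rw [map_mul, map_mul] at this
  exact this

section
variable {M : ℕ} {b : Vertex M → ℂ} {A : Type*} [Ring A] [Algebra ℂ A]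

theorem pairwise_commute (ρ : ExtendedFFDAlgebra M b →ₐ[ℂ] A) {S : Finset (Vertex M)}
    (hS : (frustrationGraph M).IsIndepSet (S : Set (Vertex M))) :
    (S : Set (Vertex M)).Pairwise (Function.onFun Commute fun v => ρ (gen M b v)) :=
  fun _ hu _ hv huv => (gen_commute b (hS hu hv huv)).map ρ

/-- The charge `Q_M^{(k)}` in the representation `ρ`: the sum over all independent sets `S` with
`k` elements of the frustration graph of the products of the (commuting) generators in `S`. -/
noncomputable def charge (ρ : ExtendedFFDAlgebra M b →ₐ[ℂ] A) (k : ℕ) : A :=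
  ∑ S ∈ ((frustrationGraph M).indepSetFinset k).attach,
    S.1.noncommProd (fun v => ρ (gen M b v))
      (pairwise_commute ρ (SimpleGraph.mem_indepSetFinset_iff.1 S.2).isIndepSet)

end

end ExtFFD

/-!
A product of two charges is a sum over pairs `(S, T)` of independent sets of the frustration graph,
so the claim is that the sum of `h_S h_T` over the pairs of given sizes equals the sum of `h_T h_S`,
where `h_S` is the product of the generators in `S`. The induced graph on `S ∪ T` is bipartite, and
an independent set contains at most three neighbours of a given vertex.

If no vertex had three neighbours, the components of `S ∪ T` would be paths and cycles. Those with
as many vertices in `S` as in `T` could be exchanged between the two sets, and all others would be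
paths with an even number of edges, on which `h_S` and `h_T` commute; so the exchange of all
balanced components would be an involution on pairs that reverses the order of the two factors.

Vertices with three neighbours do occur. Starting at such a vertex, one follows a chain in `S ∪ T`,
whose centres lie in one of the sets and whose leaves lie in the other. There are two outcomes.

* The chain ends with nothing next to it. It is then called a fork. At each position there are four
  chains, any of which may be substituted for another without losing independence, and the products
  of their generators add up to zero: for a chain with one centre this is the relation
  `A_{2m-1} C_{2m+2} = C_{2m} A_{2m+3}`, which moreover allows for an induction on the length
  (`IsFFDFamily.sum_chains`). Forks at different positions are too far apart for the substitutions
  to interfere, so the pairs with forks contribute nothing to either sum (`sum_without_forks`).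
* The chain is blocked by a vertex which has at most one neighbour. Blocking vertices belong to only
  one vertex with three neighbours (`Blocks.forkVertex_eq`). Hence, in the absence of forks, the
  average degree on either side of each component is at most two (`sum_degree_component_le`).

In the second case a component with `e` edges and with `s` and `t` vertices in the two sets
satisfies `e ≤ 2 s`, `e ≤ 2 t`, and `s + t ≤ e + 1` by connectedness. If `s ≠ t`, this forces `e` to
be even (`even_of_card_ne`), so `h_S` and `h_T` still commute on the unbalanced components, and
exchanging the balanced ones reverses the order of the factors
(`IsFrustratedBy.monomial_exchange_balanced`).

The combinatorics takes place on the graph of all integer labels. The generators are extended to it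
by zero, which is compatible with all the relations (`isFFDFamily_labelGen`), and for each position
the labels of the vertices contain either all four chains or none (`isChainClosed_labels`).
-/

namespace ExtFFD

open Finset

/-! ### Products over finite sets of generators -/

section Monomials

variable {ι A : Type*} [Ring A]

/-- The elements `h v` commute or anticommute according to the frustration graph `G`. -/
structure IsFrustratedBy (G : SimpleGraph ι) (h : ι → A) : Prop where
  commute : ∀ {u v}, ¬ G.Adj u v → Commute (h u) (h v)
  anticommute : ∀ {u v}, G.Adj u v → h u * h v = -(h v * h u)

/-- `S` is independent in `G`, as a condition on ordered pairs (it is harmless to allow equal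
elements, since `G` has no loops). -/
def Indep (G : SimpleGraph ι) (S : Finset ι) : Prop := ∀ u ∈ S, ∀ v ∈ S, ¬ G.Adj u v

open Classical in
/-- The product of the `h v` over `v ∈ S`, in any order. It is meant for sets `S` on which `h`
commutes, and takes the value `0` on all others. -/
noncomputable def monomial (h : ι → A) (S : Finset ι) : A :=
  if hS : (S : Set ι).Pairwise (Function.onFun Commute h) then S.noncommProd h hS else 0

theorem Indep.subset {G : SimpleGraph ι} {S T : Finset ι} (hT : Indep G T) (hST : S ⊆ T) :
    Indep G S := fun u hu v hv => hT u (hST hu) v (hST hv)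

theorem Indep.pairwise {G : SimpleGraph ι} {h : ι → A} (hG : IsFrustratedBy G h) {S : Finset ι}
    (hS : Indep G S) : (S : Set ι).Pairwise (Function.onFun Commute h) :=
  fun u hu v hv _ => hG.commute (hS u hu v hv)

theorem monomial_eq {h : ι → A} {S : Finset ι}
    (hS : (S : Set ι).Pairwise (Function.onFun Commute h)) : monomial h S = S.noncommProd h hS :=
  dif_pos hS

theorem monomial_singleton (h : ι → A) (v : ι) : monomial h {v} = h v := by
  rw [monomial_eq (by simp), noncommProd_singleton]

theorem monomial_empty (h : ι → A) : monomial h ∅ = 1 := by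
  rw [monomial_eq (by simp), noncommProd_empty]

variable {G : SimpleGraph ι} {h : ι → A}

theorem commute_monomial {a : A} {T : Finset ι} (hT : ∀ v ∈ T, Commute a (h v)) :
    Commute a (monomial h T) := by
  unfold monomial
  split_ifs
  · exact noncommProd_commute _ _ _ _ hT
  · exact Commute.zero_right a

theorem IsFrustratedBy.commute_monomials (hG : IsFrustratedBy G h) {S T : Finset ι}
    (hST : ∀ u ∈ S, ∀ v ∈ T, ¬ G.Adj u v) : Commute (monomial h S) (monomial h T) :=
  commute_monomial fun v hv =>
    (commute_monomial fun u hu => (hG.commute (hST u hu v hv)).symm).symm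

variable [DecidableEq ι]

theorem IsFrustratedBy.monomial_union (hG : IsFrustratedBy G h) {S T : Finset ι}
    (hST : Indep G (S ∪ T)) (hd : Disjoint S T) :
    monomial h (S ∪ T) = monomial h S * monomial h T := by
  rw [monomial_eq (hST.pairwise hG), monomial_eq ((hST.subset subset_union_left).pairwise hG),
    monomial_eq ((hST.subset subset_union_right).pairwise hG)]
  exact noncommProd_union_of_disjoint hd h _

theorem IsFrustratedBy.monomial_insert (hG : IsFrustratedBy G h) {v : ι} {S : Finset ι}
    (hS : Indep G (insert v S)) (hv : v ∉ S) : monomial h (insert v S) = h v * monomial h S := by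
  rw [insert_eq] at hS ⊢
  rw [hG.monomial_union hS (by simpa using hv), monomial_singleton]

theorem IsFrustratedBy.mul_monomial [DecidableRel G.Adj] (hG : IsFrustratedBy G h) (a : ι)
    {T : Finset ι} (hT : Indep G T) :
    h a * monomial h T = (-1) ^ #{w ∈ T | G.Adj a w} * (monomial h T * h a) := by
  induction T using Finset.induction_on with
  | empty => simp [monomial_empty]
  | insert v T hv ih =>
    have ih := ih (hT.subset (subset_insert _ _))
    rw [hG.monomial_insert hT hv, filter_insert]
    by_cases hav : G.Adj a v
    · rw [if_pos hav, card_insert_of_notMem (by simp [hv]), ← mul_assoc, hG.anticommute hav,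
        neg_mul, mul_assoc, ih, pow_succ]
      have := ((Commute.neg_one_left (h v)).pow_left #{w ∈ T | G.Adj a w}).eq
      simp only [mul_neg, mul_one, neg_mul, ← mul_assoc, ← this]
    · rw [if_neg hav, ← mul_assoc, (hG.commute hav).eq, mul_assoc, ih]
      have := ((Commute.neg_one_left (h v)).pow_left #{w ∈ T | G.Adj a w}).eq
      simp only [← mul_assoc, ← this]

/-- Two monomials commute up to the parity of the number of edges between their supports. -/
theorem IsFrustratedBy.monomial_mul_monomial [DecidableRel G.Adj] (hG : IsFrustratedBy G h)
    {S T : Finset ι} (hS : Indep G S) (hT : Indep G T) :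
    monomial h S * monomial h T =
      (-1) ^ (∑ v ∈ S, #{w ∈ T | G.Adj v w}) * (monomial h T * monomial h S) := by
  induction S using Finset.induction_on with
  | empty => simp [monomial_empty]
  | insert v S hv ih =>
    have ih := ih (hS.subset (subset_insert _ _))
    have key (n : ℕ) : h v * (-1) ^ n = (-1) ^ n * h v :=
      ((Commute.neg_one_left (h v)).pow_left n).eq.symm
    rw [hG.monomial_insert hS hv, sum_insert hv, mul_assoc, ih, ← mul_assoc, key, mul_assoc,
      ← mul_assoc (h v), hG.mul_monomial v hT, pow_add]
    simp only [mul_assoc]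
    rw [← mul_assoc, ← mul_assoc ((-1) ^ _) ((-1) ^ _), ← pow_add, ← pow_add, add_comm]

theorem IsFrustratedBy.commute_of_even [DecidableRel G.Adj] (hG : IsFrustratedBy G h)
    {S T : Finset ι} (hS : Indep G S) (hT : Indep G T)
    (he : Even (∑ v ∈ S, #{w ∈ T | G.Adj v w})) : Commute (monomial h S) (monomial h T) := by
  have := hG.monomial_mul_monomial hS hT
  rwa [he.neg_one_pow, one_mul] at this

end Monomials

/-! ### Exchanging two independent sets on part of their union -/

section Exchange

variable {ι A : Type*} [Ring A] {p : ι → Prop} [DecidablePred p] {S T : Finset ι}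

theorem disjoint_filters : Disjoint {v ∈ S | ¬ p v} {v ∈ T | p v} := by
  rw [disjoint_left]
  simp only [mem_filter]
  tauto

variable [DecidableEq ι]

/-- The set that agrees with `T` where `p` holds and with `S` elsewhere. -/
def exchange (p : ι → Prop) [DecidablePred p] (S T : Finset ι) : Finset ι :=
  {v ∈ S | ¬ p v} ∪ {v ∈ T | p v}

theorem mem_exchange {v : ι} : v ∈ exchange p S T ↔ v ∈ S ∧ ¬ p v ∨ v ∈ T ∧ p v := by
  simp [exchange]

theorem exchange_union_exchange : exchange p S T ∪ exchange p T S = S ∪ T := by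
  ext v
  simp only [mem_union, mem_exchange]
  tauto

theorem indep_exchange {G : SimpleGraph ι} (hS : Indep G S) (hT : Indep G T)
    (hp : ∀ u ∈ S ∪ T, ∀ v ∈ S ∪ T, G.Adj u v → (p u ↔ p v)) : Indep G (exchange p S T) := by
  intro u hu v hv huv
  rw [mem_exchange] at hu hv
  have := hp u (by simp; tauto) v (by simp; tauto) huv
  rcases hu with ⟨hu, hpu⟩ | ⟨hu, hpu⟩ <;> rcases hv with ⟨hv, hpv⟩ | ⟨hv, hpv⟩
  · exact hS u hu v hv huv
  · tauto
  · tauto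
  · exact hT u hu v hv huv

theorem card_exchange (hc : #{v ∈ S | p v} = #{v ∈ T | p v}) : #(exchange p S T) = #S := by
  rw [exchange, card_union_of_disjoint disjoint_filters, ← hc, add_comm,
    card_filter_add_card_filter_not]

/-- If no edge joins the part where `p` holds to the part where it fails, and the monomials of the
latter parts of `S` and `T` commute, then exchanging `S` and `T` where `p` holds has the same effect
on the product of their monomials as reversing the factors. -/
theorem IsFrustratedBy.monomial_exchange_mul {G : SimpleGraph ι} {h : ι → A}
    (hG : IsFrustratedBy G h) (hS : Indep G S) (hT : Indep G T)
    (hp : ∀ u ∈ S ∪ T, ∀ v ∈ S ∪ T, G.Adj u v → (p u ↔ p v))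
    (hc : Commute (monomial h {v ∈ S | ¬ p v}) (monomial h {v ∈ T | ¬ p v})) :
    monomial h (exchange p S T) * monomial h (exchange p T S) = monomial h T * monomial h S := by
  have hsplit (X : Finset ι) : {v ∈ X | ¬ p v} ∪ {v ∈ X | p v} = X := by
    rw [union_comm, filter_union_filter_not_eq]
  have h1 := hG.monomial_union (indep_exchange hS hT hp) disjoint_filters
  have h2 := hG.monomial_union (indep_exchange hT hS (by rwa [union_comm])) disjoint_filters
  have h3 := hG.monomial_union (S := {v ∈ S | ¬ p v}) (T := {v ∈ S | p v}) (by rwa [hsplit])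
    disjoint_filters
  have h4 := hG.monomial_union (S := {v ∈ T | ¬ p v}) (T := {v ∈ T | p v}) (by rwa [hsplit])
    disjoint_filters
  rw [hsplit] at h3 h4
  have hX {X Y : Finset ι} (hX : X ⊆ S ∪ T) (hY : Y ⊆ S ∪ T) :
      Commute (monomial h {v ∈ X | p v}) (monomial h {v ∈ Y | ¬ p v}) := by
    refine hG.commute_monomials fun u hu v hv huv => ?_
    rw [mem_filter] at hu hv
    have := hp u (hX hu.1) v (hY hv.1) huv
    tauto
  have c1 := (hX (X := T) (Y := T) subset_union_right subset_union_right).eq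
  have c2 := (hX (X := T) (Y := S) subset_union_right subset_union_left).eq
  change monomial h (exchange p S T) = _ at h1
  change monomial h (exchange p T S) = _ at h2
  rw [h1, h2, h3, h4, mul_assoc, ← mul_assoc _ _ (monomial h {v ∈ S | p v}), c1, mul_assoc,
    ← mul_assoc, hc.eq, mul_assoc, mul_assoc, ← mul_assoc _ _ (monomial h {v ∈ S | p v}), ← c2,
    mul_assoc]

end Exchange

/-! ### Edges of the components of two independent sets -/

section Components

variable {ι : Type*}

/-- The graph `G` with all edges removed that do not lie inside `U`. -/
def restrict (G : SimpleGraph ι) (U : Finset ι) : SimpleGraph ι where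
  Adj u v := G.Adj u v ∧ u ∈ U ∧ v ∈ U
  symm := ⟨fun _ _ h => ⟨h.1.symm, h.2.2, h.2.1⟩⟩
  loopless := ⟨fun _ h => h.1.ne rfl⟩

/-- The connected component of `v` in the subgraph of `G` on `U`. -/
def component (G : SimpleGraph ι) (U : Finset ι) (v : ι) : (restrict G U).ConnectedComponent :=
  (restrict G U).connectedComponentMk v

variable {G : SimpleGraph ι} {U S T : Finset ι}

theorem component_eq_of_adj {u v : ι} (hu : u ∈ U) (hv : v ∈ U) (huv : G.Adj u v) :
    component G U u = component G U v :=
  SimpleGraph.ConnectedComponent.connectedComponentMk_eq_of_adj ⟨huv, hu, hv⟩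

theorem mem_of_reachable {u v : ι} (h : (restrict G U).Reachable u v) (hu : u ∈ U) : v ∈ U := by
  obtain ⟨w⟩ := h
  induction w with
  | nil => exact hu
  | cons hadj _ ih => exact ih hadj.2.2

theorem eq_of_reachable {u v : ι} (h : (restrict G U).Reachable u v)
    (hu : ∀ w ∈ U, ¬ G.Adj u w) : u = v := by
  obtain ⟨w⟩ := h
  cases w with
  | nil => rfl
  | cons hadj _ => exact absurd hadj.1 (hu _ hadj.2.2)

variable [DecidableEq ι]

open Classical in
/-- A connected graph has at least as many edges as vertices, up to one; here for a component of
the bipartite graph on the union of two independent sets. -/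
theorem card_component_le (hS : Indep G S) (hT : Indep G T)
    (c : (restrict G (S ∪ T)).ConnectedComponent) (hc : ∃ v ∈ S ∪ T, component G (S ∪ T) v = c)
    (hd : Disjoint {v ∈ S | component G (S ∪ T) v = c} {v ∈ T | component G (S ∪ T) v = c}) :
    #{v ∈ S | component G (S ∪ T) v = c} + #{v ∈ T | component G (S ∪ T) v = c} ≤
      (∑ v ∈ S with component G (S ∪ T) v = c, #{w ∈ T | G.Adj v w}) + 1 := by
  obtain ⟨r, hr, rfl⟩ := hc
  set c := component G (S ∪ T) r with hcdef
  have hsupp : c.supp = ({v ∈ S | component G (S ∪ T) v = c} ∪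
      {v ∈ T | component G (S ∪ T) v = c} : Finset ι) := by
    ext v
    rw [SimpleGraph.ConnectedComponent.mem_supp_iff, mem_coe, ← filter_union, mem_filter]
    refine ⟨fun hv => ⟨?_, hv⟩, fun hv => hv.2⟩
    exact mem_of_reachable (SimpleGraph.ConnectedComponent.exact hv).symm hr
  have hfin : Finite c.supp := by rw [hsupp]; infer_instance
  have h1 := c.connected_toSimpleGraph.card_vert_le_card_edgeSet_add_one
  have h2 : Nat.card c = #{v ∈ S | component G (S ∪ T) v = c} +
      #{v ∈ T | component G (S ∪ T) v = c} := by
    rw [← card_union_of_disjoint hd, ← Set.ncard_coe_finset, ← hsupp]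
    rfl
  let P : Finset (Σ _ : ι, ι) :=
    {v ∈ S | component G (S ∪ T) v = c}.sigma fun v => {w ∈ T | G.Adj v w}
  have hP (q : P) : component G (S ∪ T) q.1.1 = c ∧ G.Adj q.1.1 q.1.2 ∧ q.1.1 ∈ S ∪ T ∧
      q.1.2 ∈ S ∪ T ∧ component G (S ∪ T) q.1.2 = c := by
    obtain ⟨⟨v, w⟩, hq⟩ := q
    simp only [P, mem_sigma, mem_filter] at hq
    have hv : v ∈ S ∪ T := mem_union_left _ hq.1.1
    have hw : w ∈ S ∪ T := mem_union_right _ hq.2.1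
    exact ⟨hq.1.2, hq.2.2, hv, hw, (component_eq_of_adj hv hw hq.2.2).symm.trans hq.1.2⟩
  let f : P → c.toSimpleGraph.edgeSet := fun q =>
    ⟨s(⟨q.1.1, (hP q).1⟩, ⟨q.1.2, (hP q).2.2.2.2⟩), (hP q).2.1, (hP q).2.2.1, (hP q).2.2.2.1⟩
  have hf : Function.Surjective f := by
    rintro ⟨e, he⟩
    induction e using Sym2.ind with
    | _ u v =>
      obtain ⟨u, hu⟩ := u
      obtain ⟨v, hv⟩ := v
      have hadj : G.Adj u v ∧ u ∈ S ∪ T ∧ v ∈ S ∪ T := he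
      have hu' : component G (S ∪ T) u = c := hu
      have hv' : component G (S ∪ T) v = c := hv
      by_cases huS : u ∈ S
      · have hvT : v ∈ T := (mem_union.1 hadj.2.2).resolve_left fun h => hS u huS v h hadj.1
        exact ⟨⟨⟨u, v⟩, by simp [P, huS, hvT, hu', hadj.1]⟩, rfl⟩
      · have huT : u ∈ T := (mem_union.1 hadj.2.1).resolve_left huS
        have hvS : v ∈ S := (mem_union.1 hadj.2.2).resolve_right fun h => hT u huT v h hadj.1
        exact ⟨⟨⟨v, u⟩, by simp [P, hvS, huT, hv', hadj.1.symm]⟩, Subtype.ext Sym2.eq_swap⟩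
  have h3 := Nat.card_le_card_of_surjective f hf
  rw [Nat.card_eq_fintype_card (α := P), Fintype.card_coe, card_sigma] at h3
  omega

/-- If the elements of degree `3` can be matched injectively with elements of degree at most `1`,
then the average degree is at most `2`. -/
theorem sum_degree_le (X : Finset ι) (d : ι → ℕ) (R : ι → ι → Prop) (h3 : ∀ v ∈ X, d v ≤ 3)
    (hex : ∀ v ∈ X, d v = 3 → ∃ w ∈ X, R v w) (hleaf : ∀ v ∈ X, ∀ w ∈ X, R v w → d w ≤ 1)
    (hinj : ∀ v ∈ X, ∀ v' ∈ X, ∀ w, R v w → R v' w → v = v') : ∑ v ∈ X, d v ≤ 2 * #X := by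
  classical
  choose! f hfX hf using hex
  have hinjOn : Set.InjOn f ({v ∈ X | d v = 3} : Finset ι) := by
    intro v hv v' hv' hvv'
    rw [mem_coe, mem_filter] at hv hv'
    exact hinj v hv.1 v' hv'.1 (f v) (hf v hv.1 hv.2) (hvv' ▸ hf v' hv'.1 hv'.2)
  have hcard := card_image_of_injOn hinjOn
  have himg : ∀ w ∈ ({v ∈ X | d v = 3} : Finset ι).image f, w ∈ X ∧ d w ≤ 1 := by
    intro w hw
    obtain ⟨v, hv, rfl⟩ := mem_image.1 hw
    rw [mem_filter] at hv
    exact ⟨hfX v hv.1 hv.2, hleaf v hv.1 _ (hfX v hv.1 hv.2) (hf v hv.1 hv.2)⟩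
  have hsum : ∑ v ∈ X, (d v + if v ∈ ({v ∈ X | d v = 3} : Finset ι).image f then 1 else 0) ≤
      ∑ v ∈ X, (2 + if d v = 3 then 1 else 0) := by
    refine sum_le_sum fun v hv => ?_
    have := h3 v hv
    split_ifs with h1 h2 h2
    · have := (himg v h1).2
      omega
    · have := (himg v h1).2
      omega
    · omega
    · omega
  rw [sum_add_distrib, sum_add_distrib, ← card_filter, ← card_filter, sum_const, smul_eq_mul,
    filter_mem_eq_inter, inter_eq_right.2 fun w hw => (himg w hw).1, hcard] at hsum
  omega

open Classical in
/-- A component with an odd number of edges in which the average degree on either side is at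
most `2` is balanced. -/
theorem even_of_card_ne (hS : Indep G S) (hT : Indep G T)
    (c : (restrict G (S ∪ T)).ConnectedComponent)
    (hdS : ∑ v ∈ S with component G (S ∪ T) v = c, #{w ∈ T | G.Adj v w} ≤
      2 * #{v ∈ S | component G (S ∪ T) v = c})
    (hdT : ∑ v ∈ T with component G (S ∪ T) v = c, #{w ∈ S | G.Adj v w} ≤
      2 * #{v ∈ T | component G (S ∪ T) v = c})
    (hc : #{v ∈ S | component G (S ∪ T) v = c} ≠ #{v ∈ T | component G (S ∪ T) v = c}) :
    Even (∑ v ∈ S with component G (S ∪ T) v = c, #{w ∈ T | G.Adj v w}) := by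
  by_cases hd : Disjoint {v ∈ S | component G (S ∪ T) v = c} {v ∈ T | component G (S ∪ T) v = c}
  · by_cases hne : ∃ v ∈ S ∪ T, component G (S ∪ T) v = c
    · have h1 := card_component_le hS hT c hne hd
      have h2 : ∑ v ∈ T with component G (S ∪ T) v = c, #{w ∈ S | G.Adj v w} =
          ∑ v ∈ S with component G (S ∪ T) v = c, #{w ∈ T | G.Adj v w} := by
        have h3 := sum_card_bipartiteAbove_eq_sum_card_bipartiteBelow (r := G.Adj)
          (s := {v ∈ S | component G (S ∪ T) v = c}) (t := {v ∈ T | component G (S ∪ T) v = c})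
        refine (sum_congr rfl fun v hv => ?_).trans (h3.symm.trans (sum_congr rfl fun v hv => ?_))
        · rw [mem_filter] at hv
          congr 1
          ext w
          simp only [bipartiteBelow, mem_filter]
          refine ⟨fun hw => ⟨⟨hw.1, ?_⟩, hw.2.symm⟩, fun hw => ⟨hw.1.1, hw.2.symm⟩⟩
          exact (component_eq_of_adj (mem_union_left _ hw.1) (mem_union_right _ hv.1)
            hw.2.symm).trans hv.2
        · rw [mem_filter] at hv
          congr 1
          ext w
          simp only [bipartiteAbove, mem_filter]
          refine ⟨fun hw => ⟨hw.1.1, hw.2⟩, fun hw => ⟨⟨hw.1, ?_⟩, hw.2⟩⟩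
          exact (component_eq_of_adj (mem_union_right _ hw.1) (mem_union_left _ hv.1)
            hw.2.symm).trans hv.2
      rw [h2] at hdT
      by_contra hodd
      rw [Nat.not_even_iff_odd] at hodd
      obtain ⟨n, hn⟩ := hodd
      omega
    · refine absurd ?_ hc
      push Not at hne
      rw [filter_false_of_mem fun v hv => hne v (mem_union_left _ hv),
        filter_false_of_mem fun v hv => hne v (mem_union_right _ hv)]
  · -- A common element of `S` and `T` is isolated, so it forms a component of its own.
    rw [not_disjoint_iff] at hd
    obtain ⟨v, hvS, hvT⟩ := hd
    rw [mem_filter] at hvS hvT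
    have hiso : ∀ w ∈ S ∪ T, ¬ G.Adj v w := fun w hw => (mem_union.1 hw).elim
      (fun hw => hS v hvS.1 w hw) fun hw => hT v hvT.1 w hw
    have heq {X : Finset ι} (hX : v ∈ X) :
        ({w ∈ X | component G (S ∪ T) w = c} : Finset ι) = {v} := by
      ext w
      rw [mem_filter, mem_singleton]
      refine ⟨fun hw => ?_, fun hw => hw ▸ ⟨hX, hvS.2⟩⟩
      exact (eq_of_reachable (SimpleGraph.ConnectedComponent.exact (hvS.2.trans hw.2.symm))
        hiso).symm
    exact absurd (by rw [heq hvS.1, heq hvT.1]) hc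

end Components

end ExtFFD

namespace ExtFFD

open Finset

/-! ### Exchanging two independent sets on their balanced components -/

section Balanced

open Classical in
/-- The component of `v` in the subgraph of `G` on `U` has as many elements in `S` as in `T`. -/
def IsBalanced {ι : Type*} (G : SimpleGraph ι) (U S T : Finset ι) (v : ι) : Prop :=
  #{w ∈ S | component G U w = component G U v} = #{w ∈ T | component G U w = component G U v}

variable {ι A : Type*} [Ring A] {G : SimpleGraph ι} {U S T : Finset ι}

theorem isBalanced_congr {v w : ι} (h : component G U v = component G U w) :
    IsBalanced G U S T v ↔ IsBalanced G U S T w := by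
  unfold IsBalanced
  rw [h]

open Classical in
theorem card_balanced : #{v ∈ S | IsBalanced G U S T v} = #{v ∈ T | IsBalanced G U S T v} := by
  have key (X : Finset ι) (hX : X ⊆ S ∪ T) := card_eq_sum_card_fiberwise (f := component G U)
    (s := {v ∈ X | IsBalanced G U S T v}) (t := (S ∪ T).image (component G U))
    fun v hv => mem_image_of_mem _ (hX (mem_filter.1 hv).1)
  rw [key S subset_union_left, key T subset_union_right]
  refine sum_congr rfl fun c hc => ?_
  obtain ⟨r, -, rfl⟩ := mem_image.1 hc
  simp only [filter_filter]
  by_cases hr : IsBalanced G U S T r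
  · have key2 (X : Finset ι) : {v ∈ X | IsBalanced G U S T v ∧ component G U v = component G U r} =
        {v ∈ X | component G U v = component G U r} :=
      filter_congr fun v _ => and_iff_right_of_imp fun h => (isBalanced_congr h).2 hr
    rw [key2, key2]
    exact hr
  · rw [filter_false_of_mem fun v _ h => hr ((isBalanced_congr h.2).1 h.1),
      filter_false_of_mem fun v _ h => hr ((isBalanced_congr h.2).1 h.1)]

theorem isBalanced_exchange [DecidableEq ι] [DecidablePred (IsBalanced G U S T)] {v : ι} :
    IsBalanced G U (exchange (IsBalanced G U S T) S T) (exchange (IsBalanced G U S T) T S) v ↔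
      IsBalanced G U S T v := by
  classical
  have key (X Y : Finset ι) :
      {w ∈ exchange (IsBalanced G U S T) X Y | component G U w = component G U v} =
        if IsBalanced G U S T v then {w ∈ Y | component G U w = component G U v}
        else {w ∈ X | component G U w = component G U v} := by
    ext w
    split_ifs with hv <;> simp only [mem_filter, mem_exchange]
    · refine ⟨fun h => ?_, fun h => ?_⟩ <;> have := isBalanced_congr (S := S) (T := T) h.2 <;> tauto
    · refine ⟨fun h => ?_, fun h => ?_⟩ <;> have := isBalanced_congr (S := S) (T := T) h.2 <;> tauto
  rw [IsBalanced, key, key]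
  split_ifs with hv
  · exact iff_of_true hv.symm hv
  · exact Iff.rfl

theorem isBalanced_iff_of_adj {u v : ι} (hu : u ∈ U) (hv : v ∈ U) (huv : G.Adj u v) :
    IsBalanced G U S T u ↔ IsBalanced G U S T v :=
  isBalanced_congr (component_eq_of_adj hu hv huv)

variable [DecidableEq ι]

open Classical in
/-- If the components of `S ∪ T` have average degree at most `2` on either side, then exchanging
`S` and `T` on the balanced components reverses the order in the product of their monomials: the
other components have an even number of edges. -/
theorem IsFrustratedBy.monomial_exchange_balanced {h : ι → A} (hG : IsFrustratedBy G h)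
    (hS : Indep G S) (hT : Indep G T)
    (hdS : ∀ c, ∑ v ∈ S with component G (S ∪ T) v = c, #{w ∈ T | G.Adj v w} ≤
      2 * #{v ∈ S | component G (S ∪ T) v = c})
    (hdT : ∀ c, ∑ v ∈ T with component G (S ∪ T) v = c, #{w ∈ S | G.Adj v w} ≤
      2 * #{v ∈ T | component G (S ∪ T) v = c}) :
    monomial h (exchange (IsBalanced G (S ∪ T) S T) S T) *
      monomial h (exchange (IsBalanced G (S ∪ T) S T) T S) = monomial h T * monomial h S := by
  refine hG.monomial_exchange_mul hS hT (fun u hu v hv => isBalanced_iff_of_adj hu hv) ?_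
  refine hG.commute_of_even (hS.subset (filter_subset _ _)) (hT.subset (filter_subset _ _)) ?_
  have h1 : ∀ v ∈ ({v ∈ S | ¬ IsBalanced G (S ∪ T) S T v} : Finset ι),
      #{w ∈ {w ∈ T | ¬ IsBalanced G (S ∪ T) S T w} | G.Adj v w} = #{w ∈ T | G.Adj v w} := by
    intro v hv
    rw [mem_filter] at hv
    rw [filter_filter]
    congr 1
    refine filter_congr fun w hw => and_iff_right_of_imp fun hvw => ?_
    rw [← isBalanced_iff_of_adj (mem_union_left _ hv.1) (mem_union_right _ hw) hvw]
    exact hv.2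
  rw [sum_congr rfl h1, ← sum_fiberwise_of_maps_to (g := component G (S ∪ T))
    (t := S.image (component G (S ∪ T))) fun v hv => mem_image_of_mem _ (mem_filter.1 hv).1]
  refine even_sum _ fun c hc => ?_
  obtain ⟨r, -, rfl⟩ := mem_image.1 hc
  rw [filter_filter]
  by_cases hr : IsBalanced G (S ∪ T) S T r
  · rw [filter_false_of_mem fun v _ h => h.1 ((isBalanced_congr h.2).2 hr)]
    simp
  · rw [filter_congr fun v _ => and_iff_right_of_imp fun h => by rwa [isBalanced_congr h]]
    exact even_of_card_ne hS hT _ (hdS _) (hdT _) hr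

end Balanced

/-! ### Sums over a set with cancelling moves -/

/-- If every element of `Q` is of exactly one of finitely many kinds, and can be changed to
any other kind in such a way that the values of `F` on the variants of one element sum to zero, then
`F` sums to zero over `Q`. -/
theorem sum_eq_zero_of_moves {P κ A : Type*} [Fintype κ] [Nonempty κ] [AddCommMonoid A]
    (Q : Finset P) (F : P → A) (K : κ → P → Prop) (mv : κ → P → P)
    (hK : ∀ p ∈ Q, ∃ i, K i p) (huniq : ∀ i j p, K i p → K j p → i = j)
    (hmv : ∀ p ∈ Q, ∀ i, mv i p ∈ Q ∧ K i (mv i p))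
    (hinv : ∀ p ∈ Q, ∀ i j, K i p → mv i (mv j p) = p)
    (hF : ∀ p ∈ Q, ∑ i, F (mv i p) = 0) : ∑ p ∈ Q, F p = 0 := by
  classical
  choose! f hf using hK
  have hfK {i p} (hp : p ∈ Q) : f p = i ↔ K i p :=
    ⟨fun h => h ▸ hf p hp, fun h => huniq _ _ _ (hf p hp) h⟩
  obtain ⟨o⟩ := ‹Nonempty κ›
  rw [← sum_fiberwise Q f F]
  have key (i : κ) : ∑ p ∈ Q with f p = i, F p = ∑ p ∈ Q with f p = o, F (mv i p) := by
    symm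
    refine sum_nbij' (mv i) (mv o) ?_ ?_ ?_ ?_ fun _ _ => rfl
    · intro p hp
      rw [mem_filter] at hp ⊢
      exact ⟨(hmv p hp.1 i).1, (hfK (hmv p hp.1 i).1).2 (hmv p hp.1 i).2⟩
    · intro p hp
      rw [mem_filter] at hp ⊢
      exact ⟨(hmv p hp.1 o).1, (hfK (hmv p hp.1 o).1).2 (hmv p hp.1 o).2⟩
    · intro p hp
      rw [mem_filter] at hp
      exact hinv p hp.1 o i ((hfK hp.1).1 hp.2)
    · intro p hp
      rw [mem_filter] at hp
      exact hinv p hp.1 i o ((hfK hp.1).1 hp.2)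
  simp_rw [key]
  rw [sum_comm]
  exact sum_eq_zero fun p hp => hF p (mem_filter.1 hp).1

end ExtFFD

namespace ExtFFD

open Finset

/-! ### The frustration graph on integer labels -/

/-- Labels without bounds: `inl j` stands for `h_j` and `inr k` for `hbar_{2 k + 1}`. -/
abbrev Label : Type := ℤ ⊕ ℤ

/-- Adjacency of labels; on the labels that occur for a given `M` it is the adjacency of the
frustration graph. -/
def LabelAdj : Label → Label → Prop
  | .inl i, .inl j => i ≠ j ∧ i ≤ j + 2 ∧ j ≤ i + 2
  | .inr k, .inr l => k = l + 1 ∨ l = k + 1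
  | .inl j, .inr k => MixedAdj j (2 * k + 1)
  | .inr k, .inl j => MixedAdj j (2 * k + 1)

instance (u v : Label) : Decidable (LabelAdj u v) := by
  rcases u with i | i <;> rcases v with j | j <;> unfold LabelAdj <;> infer_instance

/-- The frustration graph on all labels. -/
def labelGraph : SimpleGraph Label where
  Adj := LabelAdj
  symm := ⟨by
    rintro (i | i) (j | j) h
    · exact ⟨h.1.symm, h.2.2, h.2.1⟩
    · exact h
    · exact h
    · exact Or.symm h⟩
  loopless := ⟨by
    rintro (i | i) h
    · exact h.1 rfl
    · rcases h with h | h <;> omega⟩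

instance : DecidableRel labelGraph.Adj := fun u v => inferInstanceAs (Decidable (LabelAdj u v))

theorem adj_inl_inl {i j : ℤ} :
    labelGraph.Adj (.inl i) (.inl j) ↔ i ≠ j ∧ i ≤ j + 2 ∧ j ≤ i + 2 := Iff.rfl

theorem adj_inr_inr {k l : ℤ} : labelGraph.Adj (.inr k) (.inr l) ↔ k = l + 1 ∨ l = k + 1 := Iff.rfl

theorem adj_inl_inr {j k : ℤ} : labelGraph.Adj (.inl j) (.inr k) ↔
    j = 2 * k - 5 ∨ j = 2 * k - 3 ∨ j = 2 * k - 1 ∨ j = 2 * k + 1 ∨ j = 2 * k ∨ j = 2 * k + 2 := by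
  change MixedAdj _ _ ↔ _
  unfold MixedAdj
  omega

theorem adj_inr_inl {j k : ℤ} : labelGraph.Adj (.inr k) (.inl j) ↔
    j = 2 * k - 5 ∨ j = 2 * k - 3 ∨ j = 2 * k - 1 ∨ j = 2 * k + 1 ∨ j = 2 * k ∨ j = 2 * k + 2 :=
  (labelGraph.adj_comm _ _).trans adj_inl_inr

/-! ### Chains -/

/-- The two pairs of generators in `A_{2m-1} = h_{2m} h_{2m-3} + h_{2m-2} hbar_{2m+1}`. -/
def hinge (m : ℤ) : Bool → Finset Label
  | false => {.inl (2 * m), .inl (2 * m - 3)}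
  | true => {.inl (2 * m - 2), .inr m}

/-- The centres of a chain at the position `(m, n)`.

A chain is a path in `labelGraph` that alternates between `n` centres and `n` ends, together with a
hinge, which is a pair of labels attached to the outermost centre. The ends and the two labels of
the hinge are called the leaves of the chain; neither two centres nor two leaves are adjacent. At
each position `(m, n)` with `0 < n` there are four chains, whose kind is a pair of Booleans `κ`: the
first one is `false` if the hinge is on the left and `true` if it is on the right, and the second
one selects a summand of `A_{2m-1}` or `A_{2m+4n-1}`, respectively.

The centres are `h_{2m-1}, h_{2m+3}, …, h_{2m+4n-5}` if the hinge is on the left, and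
`hbar_{2m+3}, hbar_{2m+7}, …, hbar_{2m+4n-1}` if it is on the right. -/
def chainCenters (m : ℤ) (n : ℕ) : Bool → Finset Label
  | false => (range n).image fun i : ℕ => .inl (2 * m - 1 + 4 * i)
  | true => (range n).image fun i : ℕ => .inr (m + 1 + 2 * i)

/-- The leaves of a chain that do not belong to the hinge: `hbar_{2m+5}, hbar_{2m+9}, …,
hbar_{2m+4n+1}` if the hinge is on the left, and `h_{2m-3}, h_{2m+1}, …, h_{2m+4n-7}` if it is on
the right. -/
def chainEnds (m : ℤ) (n : ℕ) : Bool → Finset Label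
  | false => (range n).image fun i : ℕ => .inr (m + 2 + 2 * i)
  | true => (range n).image fun i : ℕ => .inl (2 * m - 3 + 4 * i)

/-- The hinge of a chain at the position `(m, n)` is `hinge k` for this value of `k`. -/
def hingePos (m : ℤ) (n : ℕ) : Bool → ℤ
  | false => m
  | true => m + 2 * n

/-- The leaves of the chain of kind `κ` at the position `(m, n)`. -/
def chainLeaves (m : ℤ) (n : ℕ) (κ : Bool × Bool) : Finset Label :=
  hinge (hingePos m n κ.1) κ.2 ∪ chainEnds m n κ.1

/-- Membership in `chainCenters`, in a form suited to linear arithmetic. -/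
def IsCenter (m : ℤ) (n : ℕ) : Bool → Label → Prop
  | false, .inl j => 2 * m - 1 ≤ j ∧ j ≤ 2 * m + 4 * n - 5 ∧ (j - 2 * m) % 4 = 3
  | true, .inr k => m + 1 ≤ k ∧ k ≤ m + 2 * n - 1 ∧ (k - m) % 2 = 1
  | _, _ => False

/-- Membership in `chainLeaves`, in a form suited to linear arithmetic. -/
def IsLeaf (m : ℤ) (n : ℕ) : Bool × Bool → Label → Prop
  | (false, false), .inl j => j = 2 * m ∨ j = 2 * m - 3
  | (false, true), .inl j => j = 2 * m - 2
  | (true, false), .inl j => j = 2 * m + 4 * n ∨ j = 2 * m + 4 * n - 3 ∨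
      2 * m - 3 ≤ j ∧ j ≤ 2 * m + 4 * n - 7 ∧ (j - 2 * m) % 4 = 1
  | (true, true), .inl j => j = 2 * m + 4 * n - 2 ∨
      2 * m - 3 ≤ j ∧ j ≤ 2 * m + 4 * n - 7 ∧ (j - 2 * m) % 4 = 1
  | (false, false), .inr k => m + 2 ≤ k ∧ k ≤ m + 2 * n ∧ (k - m) % 2 = 0
  | (false, true), .inr k => k = m ∨ m + 2 ≤ k ∧ k ≤ m + 2 * n ∧ (k - m) % 2 = 0
  | (true, false), .inr _ => False
  | (true, true), .inr k => k = m + 2 * n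

/-- A set of labels that contains, for each of the four chains at the position `(m, n)`, the
centres and all their neighbours. -/
def CenterZone (m : ℤ) (n : ℕ) : Label → Prop
  | .inl j => 2 * m - 3 ≤ j ∧ j ≤ 2 * m + 4 * n
  | .inr k => m - 1 ≤ k ∧ k ≤ m + 2 * n

/-- The closed neighbourhood of the leaves, which is the same for each of the four chains at the
position `(m, n)`. -/
def LeafZone (m : ℤ) (n : ℕ) : Label → Prop
  | .inl j => 2 * m - 5 ≤ j ∧ j ≤ 2 * m + 4 * n + 2
  | .inr k => m - 2 ≤ k ∧ k ≤ m + 2 * n + 1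

instance (m : ℤ) (n : ℕ) : DecidablePred (CenterZone m n) := fun v => by
  rcases v with j | k <;> unfold CenterZone <;> infer_instance

instance (m : ℤ) (n : ℕ) : DecidablePred (LeafZone m n) := fun v => by
  rcases v with j | k <;> unfold LeafZone <;> infer_instance

variable {m m' : ℤ} {n n' : ℕ} {s s' : Bool} {κ κ' : Bool × Bool} {u v w : Label}

theorem mem_image_range_inl {a : ℤ} {j : ℤ} :
    (.inl j : Label) ∈ (range n).image (fun i : ℕ => (.inl (a + 4 * i) : Label)) ↔
      a ≤ j ∧ j ≤ a + 4 * n - 4 ∧ (j - a) % 4 = 0 := by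
  simp only [mem_image, mem_range, Sum.inl.injEq]
  constructor
  · rintro ⟨i, hi, rfl⟩
    omega
  · intro h
    exact ⟨((j - a) / 4).toNat, by omega, by omega⟩

theorem mem_image_range_inr {a : ℤ} {k : ℤ} :
    (.inr k : Label) ∈ (range n).image (fun i : ℕ => (.inr (a + 2 * i) : Label)) ↔
      a ≤ k ∧ k ≤ a + 2 * n - 2 ∧ (k - a) % 2 = 0 := by
  simp only [mem_image, mem_range, Sum.inr.injEq]
  constructor
  · rintro ⟨i, hi, rfl⟩
    omega
  · intro h
    exact ⟨((k - a) / 2).toNat, by omega, by omega⟩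

theorem inl_notMem_image {f : ℕ → ℤ} {j : ℤ} :
    (.inl j : Label) ∉ (range n).image (fun i => (.inr (f i) : Label)) := by simp

theorem inr_notMem_image {f : ℕ → ℤ} {k : ℤ} :
    (.inr k : Label) ∉ (range n).image (fun i => (.inl (f i) : Label)) := by simp

theorem mem_chainCenters : v ∈ chainCenters m n s ↔ IsCenter m n s v := by
  rcases s <;> rcases v with j | k <;> unfold chainCenters IsCenter
  · rw [mem_image_range_inl]
    omega
  · simp
  · simp
  · rw [mem_image_range_inr]
    omega

theorem mem_chainLeaves : v ∈ chainLeaves m n κ ↔ IsLeaf m n κ v := by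
  rcases κ with ⟨_ | _, _ | _⟩ <;> rcases v with j | k <;>
    simp only [chainLeaves, hinge, hingePos, chainEnds, IsLeaf, mem_union, mem_insert,
      mem_singleton, mem_image_range_inl, mem_image_range_inr, inl_notMem_image, inr_notMem_image,
      Sum.inl.injEq, Sum.inr.injEq, reduceCtorEq, or_false, false_or] <;> omega

theorem centerZone_of_isCenter (h : IsCenter m n s v) : CenterZone m n v := by
  rcases s <;> rcases v with j | k <;> simp only [IsCenter, CenterZone] at h ⊢ <;> omega

theorem leafZone_of_isLeaf (hn : 0 < n) (h : IsLeaf m n κ v) : LeafZone m n v := by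
  rcases κ with ⟨_ | _, _ | _⟩ <;> rcases v with j | k <;>
    simp only [IsLeaf, LeafZone] at h ⊢ <;> omega

theorem leafZone_of_centerZone (h : CenterZone m n v) : LeafZone m n v := by
  rcases v with j | k <;> simp only [CenterZone, LeafZone] at h ⊢ <;> omega

theorem indep_chainCenters : Indep labelGraph (chainCenters m n s) := by
  intro u hu v hv
  rw [mem_chainCenters] at hu hv
  rcases s <;> rcases u with a | a <;> rcases v with b | b <;>
    simp only [IsCenter, adj_inl_inl, adj_inr_inr] at hu hv ⊢ <;> omega

theorem indep_chainLeaves : Indep labelGraph (chainLeaves m n κ) := by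
  intro u hu v hv
  rw [mem_chainLeaves] at hu hv
  rcases κ with ⟨_ | _, _ | _⟩ <;> rcases u with a | a <;> rcases v with b | b <;>
    simp only [IsLeaf, adj_inl_inl, adj_inl_inr, adj_inr_inl, adj_inr_inr] at hu hv ⊢ <;> omega

theorem centerZone_of_adj (hv : IsCenter m n s v) (huv : labelGraph.Adj u v) :
    CenterZone m n u := by
  rcases s <;> rcases u with a | a <;> rcases v with b | b <;>
    simp only [IsCenter, CenterZone, adj_inl_inl, adj_inl_inr, adj_inr_inl, adj_inr_inr]
      at hv huv ⊢ <;> omega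

theorem leafZone_of_adj (hn : 0 < n) (hv : IsLeaf m n κ v) (huv : labelGraph.Adj u v) :
    LeafZone m n u := by
  rcases κ with ⟨_ | _, _ | _⟩ <;> rcases u with a | a <;> rcases v with b | b <;>
    simp only [IsLeaf, LeafZone, adj_inl_inl, adj_inl_inr, adj_inr_inl, adj_inr_inr]
      at hv huv ⊢ <;> omega

/-- The leaf zone is contained in the closed neighbourhood of the leaves, so an independent set that
contains the leaves has no other elements in the leaf zone. -/
theorem isLeaf_of_leafZone (hn : 0 < n) (hz : LeafZone m n u)
    (h : ∀ v, IsLeaf m n κ v → ¬ labelGraph.Adj u v) : IsLeaf m n κ u := by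
  have hl (j : ℤ) := h (.inl j)
  have hr (k : ℤ) := h (.inr k)
  clear h
  -- In each case, some hinge label or the end closest to `u` is equal or adjacent to `u`.
  rcases κ with ⟨_ | _, _ | _⟩ <;> rcases u with a | a <;>
    simp only [IsLeaf, LeafZone, adj_inl_inl, adj_inl_inr, adj_inr_inl, adj_inr_inr]
      at hz hl hr ⊢
  · have h1 := hl (2 * m)
    have h2 := hl (2 * m - 3)
    have h3 := hr (m + 2 + 2 * ((a - 2 * m - 3) / 4))
    omega
  · have h1 := hl (2 * m)
    have h2 := hl (2 * m - 3)
    have h3 := hr (a - 1)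
    have h4 := hr (a + 1)
    omega
  · have h1 := hl (2 * m - 2)
    have h2 := hr m
    have h3 := hr (m + 2 + 2 * ((a - 2 * m - 3) / 4))
    omega
  · have h1 := hl (2 * m - 2)
    have h2 := hr m
    have h3 := hr (a - 1)
    have h4 := hr (a + 1)
    omega
  · have h1 := hl (2 * m + 4 * n)
    have h2 := hl (2 * m + 4 * n - 3)
    have h3 := hl (2 * m - 3 + 4 * ((a - 2 * m + 5) / 4))
    omega
  · have h1 := hl (2 * m + 4 * n)
    have h2 := hl (2 * m + 4 * n - 3)
    have h3 := hl (2 * m - 3 + 4 * ((a - m) / 2))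
    have h4 := hl (2 * m - 3)
    omega
  · have h1 := hl (2 * m + 4 * n - 2)
    have h2 := hr (m + 2 * n)
    have h3 := hl (2 * m - 3 + 4 * ((a - 2 * m + 5) / 4))
    omega
  · have h1 := hl (2 * m + 4 * n - 2)
    have h2 := hr (m + 2 * n)
    have h3 := hl (2 * m - 3 + 4 * ((a - m) / 2))
    have h4 := hl (2 * m - 3)
    omega

end ExtFFD

namespace ExtFFD

open Finset

variable {m m' : ℤ} {n n' : ℕ} {s s' : Bool} {κ κ' : Bool × Bool} {u v w : Label}

/-! ### Distinct chains in a pair of independent sets are far apart -/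

/-- Two chains with overlapping zones that agree where the zones overlap are at the same position.
It suffices to compare them at both ends of the overlap. -/
theorem eq_of_agree (hn : 0 < n) (hn' : 0 < n') (hle : m ≤ m') (hlt : m' ≤ m + 2 * n + 2)
    (hC : ∀ v, CenterZone m n v → CenterZone m' n' v →
      (IsCenter m n κ.1 v ↔ IsCenter m' n' κ'.1 v))
    (hL : ∀ v, LeafZone m n v → LeafZone m' n' v → (IsLeaf m n κ v ↔ IsLeaf m' n' κ' v)) :
    m = m' ∧ n = n' := by
  have hCl (j : ℤ) := hC (.inl j)
  have hCr (j : ℤ) := hC (.inr j)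
  have hLl (j : ℤ) := hL (.inl j)
  have hLr (j : ℤ) := hL (.inr j)
  clear hC hL
  have a1 := hLl (2 * m' - 3)
  have a2 := hLl (2 * m' - 2)
  obtain ⟨_ | _, α⟩ := κ <;> obtain ⟨_ | _, β⟩ := κ'
  · have a3 := hCl (2 * m' - 1)
    have a4 := hCl (2 * m + 4 * n - 1)
    have a5 := hCl (2 * m' + 4 * n' - 1)
    clear hCl hCr hLl hLr
    rcases α <;> rcases β <;>
      simp only [IsLeaf, IsCenter, LeafZone, CenterZone] at a1 a2 a3 a4 a5
    all_goals grind
  · have a3 := hCr (m' + 1)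
    clear hCl hCr hLl hLr a2
    rcases α <;> rcases β <;> simp only [IsLeaf, IsCenter, LeafZone, CenterZone] at a1 a3
    all_goals grind
  · have a3 := hCl (2 * m' - 1)
    have a4 := hLr m'
    clear hCl hCr hLl hLr
    rcases α <;> rcases β <;> simp only [IsLeaf, IsCenter, LeafZone, CenterZone] at a1 a2 a3 a4
    all_goals grind
  · have a3 := hCr (m' - 1)
    have a4 := hLl (2 * m + 4 * n)
    have a5 := hLr (m + 2 * n)
    have a6 := hLl (2 * m' + 4 * n')
    have a7 := hLr (m' + 2 * n')
    clear hCl hCr hLl hLr a2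
    obtain rfl : m = m' := by
      clear a4 a5 a6 a7
      rcases α <;> rcases β <;> simp only [IsLeaf, IsCenter, LeafZone, CenterZone] at a1 a3
      all_goals grind
    clear a1 a3
    rcases α <;> rcases β <;> simp only [IsLeaf, LeafZone] at a4 a5 a6 a7
    all_goals grind

/-- The centres of one chain cannot agree with the leaves of another one, and conversely, on
overlapping zones. -/
theorem false_of_agree_swap (hn : 0 < n) (hn' : 0 < n') (hle : m ≤ m') (hlt : m' ≤ m + 2 * n + 1)
    (hC : ∀ v, CenterZone m n v → LeafZone m' n' v → (IsCenter m n κ.1 v ↔ IsLeaf m' n' κ' v))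
    (hL : ∀ v, LeafZone m n v → CenterZone m' n' v → (IsLeaf m n κ v ↔ IsCenter m' n' κ'.1 v)) :
    False := by
  have hCl (j : ℤ) := hC (.inl j)
  have hLl (j : ℤ) := hL (.inl j)
  have hLr (j : ℤ) := hL (.inr j)
  clear hC hL
  obtain ⟨t, β⟩ := κ'
  cases t
  · have a1 := hLl (2 * m' - 1)
    have a2 := hCl (2 * m')
    have a3 := hCl (2 * m' - 2)
    clear hCl hLl hLr
    rcases κ with ⟨_ | _, _ | _⟩ <;> rcases β <;>
      simp only [IsLeaf, IsCenter, LeafZone, CenterZone] at a1 a2 a3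
    all_goals grind
  · have a1 := hCl (2 * m' - 3)
    have a2 := hLr (m' - 1)
    have a3 := hLl (2 * m)
    have a4 := hLr (m' + 1)
    clear hCl hLl hLr
    rcases κ with ⟨_ | _, _ | _⟩ <;> rcases β <;>
      simp only [IsLeaf, IsCenter, LeafZone, CenterZone] at a1 a2 a3 a4
    all_goals grind

/-! ### Elements with three neighbours in an independent set -/

/-- The centre of a chain to which its hinge is attached. -/
def forkVertex (m : ℤ) (n : ℕ) : Bool → Label
  | false => .inl (2 * m - 1)
  | true => .inr (m + 2 * n - 1)

theorem card_le_three {N : Finset Label} (g : Label → Fin 3) (hg : Set.InjOn g N) :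
    #N ≤ 3 ∧ (#N = 3 → ∀ i, ∃ w ∈ N, g w = i) := by
  have h1 : #(N.image g) = #N := card_image_of_injOn hg
  have h2 : #(N.image g) ≤ 3 := (card_le_univ _).trans (by simp)
  refine ⟨by omega, fun h i => ?_⟩
  have h3 : N.image g = univ := eq_univ_of_card _ (by rw [h1, h, Fintype.card_fin])
  exact mem_image.1 (h3 ▸ mem_univ i)

theorem injOn_of_indep {T : Finset Label} (hT : Indep labelGraph T) {g : Label → Fin 3}
    (hg : ∀ a b, labelGraph.Adj v a → labelGraph.Adj v b → g a = g b → ¬ labelGraph.Adj a b →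
      a = b) : Set.InjOn g ({w ∈ T | labelGraph.Adj v w} : Finset Label) := by
  intro a ha b hb hab
  rw [mem_coe, mem_filter] at ha hb
  exact hg a b ha.2 hb.2 hab (hT a ha.1 b hb.1)

/-- An element has at most three neighbours in an independent set, and if it has three, it
is the centre of a chain of length one. The neighbours of a label are covered by three cliques
(for even plain labels, by two). -/
theorem card_neighbors {T : Finset Label} (hT : Indep labelGraph T) (v : Label) :
    #{w ∈ T | labelGraph.Adj v w} ≤ 3 ∧ (#{w ∈ T | labelGraph.Adj v w} = 3 →
      ∃ m κ, v = forkVertex m 1 κ.1 ∧ ∀ w, IsLeaf m 1 κ w → w ∈ T) := by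
  rcases v with j | k
  · obtain ⟨m, rfl | rfl⟩ : ∃ m, j = 2 * m ∨ j = 2 * m - 1 := ⟨(j + 1) / 2, by omega⟩
    · have h := card_le_three _ (injOn_of_indep (v := .inl (2 * m)) hT
        (g := fun w => w.elim (fun i => if i < 2 * m then 0 else 1) fun k => if k < m then 0 else 1)
        (by
          rintro (a | a) (b | b) ha hb hab hadj <;>
            simp only [adj_inl_inl, adj_inl_inr, adj_inr_inl, adj_inr_inr, Sum.inl.injEq,
              Sum.inr.injEq, reduceCtorEq, Sum.elim_inl, Sum.elim_inr] at ha hb hab hadj ⊢ <;>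
            split_ifs at hab <;> omega))
      refine ⟨h.1, fun h3 => ?_⟩
      obtain ⟨w, -, hw⟩ := h.2 h3 2
      rcases w with a | a <;> simp only [Sum.elim_inl, Sum.elim_inr] at hw <;>
        split_ifs at hw <;> simp at hw
    · have h := card_le_three _ (injOn_of_indep (v := .inl (2 * m - 1)) hT
        (g := fun w => w.elim (fun i => if i < 2 * m - 1 then 0 else 1)
          fun k => if k < m then 0 else if k = m then 1 else 2)
        (by
          rintro (a | a) (b | b) ha hb hab hadj <;>
            simp only [adj_inl_inl, adj_inl_inr, adj_inr_inl, adj_inr_inr, Sum.inl.injEq,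
              Sum.inr.injEq, reduceCtorEq, Sum.elim_inl, Sum.elim_inr] at ha hb hab hadj ⊢ <;>
            split_ifs at hab <;> omega))
      refine ⟨h.1, fun h3 => ?_⟩
      obtain ⟨a, ha, hga⟩ := h.2 h3 0
      obtain ⟨b, hb, hgb⟩ := h.2 h3 1
      obtain ⟨c, hc, hgc⟩ := h.2 h3 2
      rw [mem_filter] at ha hb hc
      have hab := hT a ha.1 b hb.1
      have hac := hT a ha.1 c hc.1
      have hbc := hT b hb.1 c hc.1
      suffices h : ∃ α : Bool, ∀ w, IsLeaf m 1 (false, α) w → w = a ∨ w = b ∨ w = c by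
        obtain ⟨α, hα⟩ := h
        refine ⟨m, (false, α), rfl, fun w hw => ?_⟩
        rcases hα w hw with rfl | rfl | rfl
        exacts [ha.1, hb.1, hc.1]
      have ha := ha.2
      have hb := hb.2
      have hc := hc.2
      clear hT h h3
      refine ⟨decide (b = .inr m), ?_⟩
      rcases a with a | a <;> rcases b with b | b <;> rcases c with c | c <;>
        simp only [adj_inl_inl, adj_inl_inr, adj_inr_inl, adj_inr_inr, Sum.elim_inl,
          Sum.elim_inr] at ha hb hc hab hac hbc hga hgb hgc <;>
        split_ifs at hga hgb hgc <;> simp only [Fin.reduceEq] at hga hgb hgc <;>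
        try omega
      all_goals
        rintro (w | w) hw <;> simp only [IsLeaf, Sum.inl.injEq, Sum.inr.injEq, reduceCtorEq,
          decide_false, decide_true, *] at hw ⊢ <;> omega
  · obtain ⟨m, rfl⟩ : ∃ m, k = m + 1 := ⟨k - 1, by omega⟩
    have h := card_le_three _ (injOn_of_indep (v := .inr (m + 1)) hT
        (g := fun w => w.elim (fun i => if i < 2 * m then 0 else if i ≤ 2 * m + 2 then 1 else 2)
          fun k => if k = m then 1 else 2)
        (by
          rintro (a | a) (b | b) ha hb hab hadj <;>
            simp only [adj_inl_inl, adj_inl_inr, adj_inr_inl, adj_inr_inr, Sum.inl.injEq,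
              Sum.inr.injEq, reduceCtorEq, Sum.elim_inl, Sum.elim_inr] at ha hb hab hadj ⊢ <;>
            split_ifs at hab <;> omega))
    refine ⟨h.1, fun h3 => ?_⟩
    obtain ⟨a, ha, hga⟩ := h.2 h3 0
    obtain ⟨b, hb, hgb⟩ := h.2 h3 1
    obtain ⟨c, hc, hgc⟩ := h.2 h3 2
    rw [mem_filter] at ha hb hc
    have hab := hT a ha.1 b hb.1
    have hac := hT a ha.1 c hc.1
    have hbc := hT b hb.1 c hc.1
    suffices h : ∃ α : Bool, ∀ w, IsLeaf m 1 (true, α) w → w = a ∨ w = b ∨ w = c by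
      obtain ⟨α, hα⟩ := h
      refine ⟨m, (true, α), by simp [forkVertex]; ring, fun w hw => ?_⟩
      rcases hα w hw with rfl | rfl | rfl
      exacts [ha.1, hb.1, hc.1]
    have ha := ha.2
    have hb := hb.2
    have hc := hc.2
    clear hT h h3
    refine ⟨decide (b = .inl (2 * m + 2)), ?_⟩
    rcases a with a | a <;> rcases b with b | b <;> rcases c with c | c <;>
      simp only [adj_inl_inl, adj_inl_inr, adj_inr_inl, adj_inr_inr, Sum.elim_inl,
        Sum.elim_inr] at ha hb hc hab hac hbc hga hgb hgc <;>
      split_ifs at hga hgb hgc <;> simp only [Fin.reduceEq] at hga hgb hgc <;>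
      try omega
    · obtain rfl : b = 2 * m + 1 := by omega
      rintro (w | w) hw <;> simp [IsLeaf] at hw ⊢
      omega
    · obtain rfl : b = 2 * m + 2 := by omega
      rintro (w | w) hw <;> simp [IsLeaf] at hw ⊢ <;> omega

end ExtFFD

namespace ExtFFD

open Finset

variable {m m' : ℤ} {n n' : ℕ} {s s' : Bool} {κ κ' : Bool × Bool} {u v w : Label}
  {S T : Finset Label}

/-! ### Chains and forks in a pair of independent sets -/

/-- `S` contains the centres and `T` the leaves of a chain. -/
def HasChain (m : ℤ) (n : ℕ) (κ : Bool × Bool) (S T : Finset Label) : Prop :=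
  (∀ v, IsCenter m n κ.1 v → v ∈ S) ∧ ∀ v, IsLeaf m n κ v → v ∈ T

/-- `S` and `T` contain a chain that can be replaced by any other one at the same position: inside
the zones, they consist of the centres and the leaves of the chain. -/
structure IsFork (m : ℤ) (n : ℕ) (κ : Bool × Bool) (S T : Finset Label) : Prop where
  pos : 0 < n
  center : ∀ v, CenterZone m n v → (v ∈ S ↔ IsCenter m n κ.1 v)
  leaf : ∀ v, LeafZone m n v → (v ∈ T ↔ IsLeaf m n κ v)

theorem IsFork.hasChain (h : IsFork m n κ S T) : HasChain m n κ S T :=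
  ⟨fun v hv => (h.center v (centerZone_of_isCenter hv)).2 hv,
    fun v hv => (h.leaf v (leafZone_of_isLeaf h.pos hv)).2 hv⟩

theorem HasChain.isLeaf_of_mem (h : HasChain m n κ S T) (hn : 0 < n) (hT : Indep labelGraph T)
    (hv : v ∈ T) (hz : LeafZone m n v) : IsLeaf m n κ v :=
  isLeaf_of_leafZone hn hz fun w hw => hT v hv w (h.2 w hw)

theorem HasChain.isFork (h : HasChain m n κ S T) (hn : 0 < n) (hT : Indep labelGraph T)
    (hS : ∀ v ∈ S, CenterZone m n v → IsCenter m n κ.1 v) : IsFork m n κ S T :=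
  ⟨hn, fun v hz => ⟨fun hv => hS v hv hz, h.1 v⟩,
    fun v hz => ⟨fun hv => h.isLeaf_of_mem hn hT hv hz, h.2 v⟩⟩

theorem isCenter_forkVertex (hn : 0 < n) : IsCenter m n s (forkVertex m n s) := by
  cases s <;> simp only [forkVertex, IsCenter] <;> omega

theorem card_chainCenters : #(chainCenters m n s) = n := by
  cases s <;> unfold chainCenters
  · rw [card_image_of_injective _ fun i j h => by simpa using h, card_range]
  · rw [card_image_of_injective _ fun i j h => by simpa using h, card_range]

theorem HasChain.le_card (h : HasChain m n κ S T) : n ≤ #S := by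
  rw [← card_chainCenters (m := m) (n := n) (s := κ.1)]
  exact card_le_card fun v hv => h.1 v (mem_chainCenters.1 hv)

/-- A chain is connected: a function that takes the same value on adjacent centres and leaves is
constant on it. -/
theorem eq_on_chain {X : Type*} (φ : Label → X) (hn : 0 < n)
    (hφ : ∀ c l, IsCenter m n κ.1 c → IsLeaf m n κ l → labelGraph.Adj c l → φ c = φ l) :
    ∀ l, IsLeaf m n κ l → φ l = φ (forkVertex m n κ.1) := by
  obtain ⟨s, α⟩ := κ
  have hleaf : ∀ k, IsLeaf m n (s, α) k → ∀ c, IsCenter m n s c → labelGraph.Adj c k →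
      φ c = φ (forkVertex m n s) → φ k = φ (forkVertex m n s) :=
    fun k hk c hc hck h => (hφ c k hc hk hck).symm.trans h
  cases s
  · have hc (i : ℕ) : i < n → φ (.inl (2 * m - 1 + 4 * i)) = φ (forkVertex m n false) := by
      induction i with
      | zero => intro _; simp [forkVertex]
      | succ i ih =>
        intro hi
        have h1 : IsLeaf m n (false, α) (.inr (m + 2 + 2 * i)) := by
          cases α <;> simp only [IsLeaf] <;> omega
        rw [← ih (by omega), hφ (.inl (2 * m - 1 + 4 * i)) _ (by simp only [IsCenter]; omega) h1
          (by rw [adj_inl_inr]; omega)]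
        exact hφ _ _ (by simp only [IsCenter]; omega) h1 (by rw [adj_inl_inr]; omega)
    rintro (j | k) hl
    · exact hleaf _ hl _ (isCenter_forkVertex hn) (by
        cases α <;> simp only [IsLeaf, forkVertex, adj_inl_inl] at hl ⊢ <;> omega) rfl
    · by_cases hk : k = m
      · exact hleaf _ hl _ (isCenter_forkVertex hn)
          (by simp only [forkVertex, adj_inl_inr]; omega) rfl
      · have hk' : m + 2 ≤ k ∧ k ≤ m + 2 * n ∧ (k - m) % 2 = 0 := by
          cases α <;> simp only [IsLeaf] at hl <;> omega
        refine hleaf _ hl (.inl (2 * m - 1 + 4 * (((k - m - 2) / 2).toNat : ℕ))) ?_ ?_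
          (hc _ (by omega))
        · simp only [IsCenter]; omega
        · rw [adj_inl_inr]; omega
  · have hc (i : ℕ) : i < n → φ (.inr (m + 2 * n - 1 - 2 * i)) = φ (forkVertex m n true) := by
      induction i with
      | zero => intro _; simp [forkVertex]
      | succ i ih =>
        intro hi
        have h1 : IsLeaf m n (true, α) (.inl (2 * m - 7 + 4 * n - 4 * i)) := by
          cases α <;> simp only [IsLeaf] <;> omega
        rw [← ih (by omega), hφ (.inr (m + 2 * n - 1 - 2 * i)) _ (by simp only [IsCenter]; omega)
          h1 (by rw [adj_inr_inl]; omega)]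
        exact hφ _ _ (by simp only [IsCenter]; omega) h1 (by rw [adj_inr_inl]; omega)
    rintro (j | k) hl
    · by_cases hj : 2 * m + 4 * n - 3 ≤ j
      · exact hleaf _ hl _ (isCenter_forkVertex hn) (by
          cases α <;> simp only [IsLeaf, forkVertex, adj_inr_inl] at hl ⊢ <;> omega) rfl
      · have hj' : 2 * m - 3 ≤ j ∧ j ≤ 2 * m + 4 * n - 7 ∧ (j - 2 * m) % 4 = 1 := by
          cases α <;> simp only [IsLeaf] at hl <;> omega
        refine hleaf _ hl (.inr (m + 2 * n - 1 - 2 * (((2 * m + 4 * n - 7 - j) / 4).toNat : ℕ)))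
          ?_ ?_ (hc _ (by omega))
        · simp only [IsCenter]; omega
        · rw [adj_inr_inl]; omega
    · exact hleaf _ hl _ (isCenter_forkVertex hn) (by
        cases α <;> simp only [IsLeaf, forkVertex, adj_inr_inr] at hl ⊢
        omega) rfl

/-- All elements of the leaf zone of a chain lie in its component. -/
theorem HasChain.component_eq (h : HasChain m n κ S T) (hn : 0 < n) {U : Finset Label}
    (hSU : S ⊆ U) (hTU : T ⊆ U) (hv : v ∈ U) (hz : LeafZone m n v) :
    component labelGraph U v = component labelGraph U (forkVertex m n κ.1) := by
  have key := eq_on_chain (κ := κ) (component labelGraph U) hn fun c l hc hl hcl =>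
    component_eq_of_adj (hSU (h.1 c hc)) (hTU (h.2 l hl)) hcl
  by_cases hadj : ∃ l, IsLeaf m n κ l ∧ labelGraph.Adj v l
  · obtain ⟨l, hl, hvl⟩ := hadj
    exact (component_eq_of_adj hv (hTU (h.2 l hl)) hvl).trans (key l hl)
  · push Not at hadj
    exact key v (isLeaf_of_leafZone hn hz hadj)

/-- The element `w ∈ S` prevents the chain from being replaced by others, and the
chain cannot be prolonged through `w`. -/
structure Blocks (m : ℤ) (n : ℕ) (κ : Bool × Bool) (S T : Finset Label) (w : Label) : Prop where
  chain : HasChain m n κ S T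
  pos : 0 < n
  mem : w ∈ S
  zone : CenterZone m n w
  notCenter : ¬ IsCenter m n κ.1 w
  left : κ.1 = false → w = .inl (2 * m + 4 * n - 1) → .inr (m + 2 * n + 2) ∉ T
  right : κ.1 = true → w = .inr (m - 1) → .inl (2 * m - 7) ∉ T

/-- The possible positions of an element that prevents the replacement of a chain. -/
theorem HasChain.zone_cases (h : HasChain m n κ S T) (hS : Indep labelGraph S) (hn : 0 < n)
    (hw : w ∈ S) (hz : CenterZone m n w) (hc : ¬ IsCenter m n κ.1 w) :
    κ.1 = false ∧ (w = .inl (2 * m + 4 * n - 2) ∨ w = .inl (2 * m + 4 * n - 1) ∨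
      w = .inl (2 * m + 4 * n)) ∨
    κ.1 = true ∧ (w = .inl (2 * m - 2) ∨ w = .inl (2 * m) ∨ w = .inr (m - 1)) := by
  have key := fun v hv => hS w hw v (h.1 v hv)
  have hl (j : ℤ) := key (.inl j)
  have hr (k : ℤ) := key (.inr k)
  clear key h hS
  obtain ⟨_ | _, α⟩ := κ <;> rcases w with a | a <;>
    simp only [IsCenter, CenterZone, adj_inl_inl, adj_inl_inr, adj_inr_inl, adj_inr_inr,
      Sum.inl.injEq, Sum.inr.injEq, reduceCtorEq, true_and, false_and, or_false, false_or]
      at hz hc hl hr ⊢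
  · have h1 := hl (2 * m - 1 + 4 * ((a - 2 * m + 3) / 4))
    have h2 := hl (2 * m - 5 + 4 * ((a - 2 * m + 3) / 4))
    omega
  · have h1 := hl (2 * m - 1 + 4 * ((a - m + 1) / 2))
    have h2 := hl (2 * m - 5 + 4 * ((a - m + 1) / 2))
    omega
  · have h1 := hr (m + 1 + 2 * ((a - 2 * m + 3) / 4))
    have h2 := hr (m - 1 + 2 * ((a - 2 * m + 3) / 4))
    omega
  · have h1 := hr (a - 1)
    have h2 := hr (a + 1)
    omega

/-- A chain that is not a fork can be prolonged until it is blocked. -/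
theorem HasChain.exists_blocks (hT : Indep labelGraph T)
    (hfork : ∀ m n κ, ¬ IsFork m n κ S T) (h : HasChain m n κ S T) (hn : 0 < n) :
    ∃ m' n' w, forkVertex m' n' κ.1 = forkVertex m n κ.1 ∧ Blocks m' n' κ S T w := by
  obtain ⟨d, hd⟩ : ∃ d, #S ≤ n + d := ⟨#S, by omega⟩
  induction d generalizing m n with
  | zero =>
    -- A chain cannot have more centres than `S` has elements.
    obtain ⟨w, hw, hz, hc⟩ : ∃ w ∈ S, CenterZone m n w ∧ ¬ IsCenter m n κ.1 w := by
      by_contra! hcon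
      exact hfork m n κ (h.isFork hn hT hcon)
    have hlt : chainCenters m n κ.1 ⊂ S := by
      refine (ssubset_iff_of_subset fun v hv => h.1 v (mem_chainCenters.1 hv)).2 ⟨w, hw, ?_⟩
      rwa [mem_chainCenters]
    have := card_lt_card hlt
    rw [card_chainCenters] at this
    omega
  | succ d ih =>
    obtain ⟨w, hw, hz, hc⟩ : ∃ w ∈ S, CenterZone m n w ∧ ¬ IsCenter m n κ.1 w := by
      by_contra! hcon
      exact hfork m n κ (h.isFork hn hT hcon)
    by_cases hl : κ.1 = false ∧ w = .inl (2 * m + 4 * n - 1) ∧ .inr (m + 2 * n + 2) ∈ T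
    · obtain ⟨hκ, rfl, hwT⟩ := hl
      have h' : HasChain m (n + 1) κ S T := by
        obtain ⟨_ | _, α⟩ := κ
        · refine ⟨fun v hv => ?_, fun v hv => ?_⟩
          · by_cases hv' : IsCenter m n false v
            · exact h.1 v hv'
            · rcases v with j | k <;> simp only [IsCenter] at hv hv'
              obtain rfl : j = 2 * m + 4 * n - 1 := by omega
              exact hw
          · by_cases hv' : IsLeaf m n (false, α) v
            · exact h.2 v hv'
            · obtain rfl : v = .inr (m + 2 * n + 2) := by
                rcases v with j | k <;> cases α <;>
                  simp only [IsLeaf, Sum.inr.injEq] at hv hv' ⊢ <;> omega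
              exact hwT
        · simp at hκ
      obtain ⟨m', n', w, hfv, hb⟩ := ih h' (by omega) (by omega)
      refine ⟨m', n', w, hfv.trans ?_, hb⟩
      rw [hκ]
      rfl
    by_cases hr : κ.1 = true ∧ w = .inr (m - 1) ∧ .inl (2 * m - 7) ∈ T
    · obtain ⟨hκ, rfl, hwT⟩ := hr
      have h' : HasChain (m - 2) (n + 1) κ S T := by
        obtain ⟨_ | _, α⟩ := κ
        · simp at hκ
        · refine ⟨fun v hv => ?_, fun v hv => ?_⟩
          · by_cases hv' : IsCenter m n true v
            · exact h.1 v hv'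
            · rcases v with j | k <;> simp only [IsCenter] at hv hv'
              obtain rfl : k = m - 1 := by omega
              exact hw
          · by_cases hv' : IsLeaf m n (true, α) v
            · exact h.2 v hv'
            · obtain rfl : v = .inl (2 * m - 7) := by
                rcases v with j | k <;> cases α <;>
                  simp only [IsLeaf, Sum.inl.injEq] at hv hv' ⊢ <;> omega
              exact hwT
      obtain ⟨m', n', w, hfv, hb⟩ := ih h' (by omega) (by omega)
      refine ⟨m', n', w, hfv.trans ?_, hb⟩
      rw [hκ]
      simp only [forkVertex, Sum.inr.injEq]
      push_cast
      ring
    exact ⟨m, n, w, rfl, h, hn, hw, hz, hc, fun h1 h2 h3 => hl ⟨h1, h2, h3⟩,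
      fun h1 h2 h3 => hr ⟨h1, h2, h3⟩⟩

/-- The chain excludes one even label from `T` at the end opposite to its hinge. -/
theorem HasChain.notMem (h : HasChain m n κ S T) (hT : Indep labelGraph T) (hn : 0 < n) :
    (κ.1 = false → .inl (2 * m + 4 * n - 2) ∉ T) ∧ (κ.1 = true → .inl (2 * m) ∉ T) := by
  have key (j : ℤ) (hj : .inl j ∈ T) v hv := hT (.inl j) hj v (h.2 v hv)
  have hl (j : ℤ) hj (i : ℤ) := key j hj (.inl i)
  have hr (j : ℤ) hj (k : ℤ) := key j hj (.inr k)
  clear key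
  constructor <;> intro hκ hmem
  · have h1 := hl _ hmem (2 * m)
    have h2 := hr _ hmem m
    have h3 := hr _ hmem (m + 2 * n - 2)
    obtain ⟨_ | _, _ | _⟩ := κ <;>
      simp only [IsLeaf, adj_inl_inl, adj_inl_inr, reduceCtorEq] at h1 h2 h3 hκ <;> grind
  · have h1 := hl _ hmem (2 * m + 1)
    have h2 := hl _ hmem (2 * m + 2)
    obtain ⟨_ | _, _ | _⟩ := κ <;>
      simp only [IsLeaf, adj_inl_inl, reduceCtorEq] at h1 h2 hκ <;> omega

/-- A blocking element has at most one neighbour in `T`. -/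
theorem Blocks.eq_of_adj (h : Blocks m n κ S T w) (hS : Indep labelGraph S)
    (hT : Indep labelGraph T) {a b : Label} (ha : a ∈ T) (hb : b ∈ T)
    (hwa : labelGraph.Adj w a) (hwb : labelGraph.Adj w b) : a = b := by
  have hcases := h.chain.zone_cases hS h.pos h.mem h.zone h.notCenter
  have hnot := h.chain.notMem hT h.pos
  have hab := hT a ha b hb
  have hn := h.pos
  rcases hcases with ⟨hκ, hw⟩ | ⟨hκ, hw⟩
  · have hleaf : .inr (m + 2 * n) ∈ T := h.chain.2 _ (by
      obtain ⟨_ | _, _ | _⟩ := κ <;> simp only [IsLeaf, reduceCtorEq] at hκ ⊢ <;> omega)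
    have key (x : Label) (hx : x ∈ T) (hwx : labelGraph.Adj w x) :
        w = .inl (2 * m + 4 * n - 2) ∧ (x = .inl (2 * m + 4 * n - 4) ∨ x = .inr (m + 2 * n - 2)) ∨
          w ≠ .inl (2 * m + 4 * n - 2) ∧ x = .inr (m + 2 * n) := by
      have h1 := hT x hx _ hleaf
      have h2 : x ≠ .inl (2 * m + 4 * n - 2) := fun hx' => hnot.1 hκ (hx' ▸ hx)
      have h3 : w = .inl (2 * m + 4 * n - 1) → x ≠ .inr (m + 2 * n + 2) :=
        fun hw hx' => h.left hκ hw (hx' ▸ hx)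
      rcases hw with rfl | rfl | rfl <;> rcases x with x | x <;>
        simp only [adj_inl_inl, adj_inl_inr, adj_inr_inr, Sum.inl.injEq, Sum.inr.injEq,
          reduceCtorEq, ne_eq, forall_const] at hwx h1 h2 h3 ⊢ <;> grind
    rcases key a ha hwa with ⟨hwa', rfl | rfl⟩ | ⟨hwa', rfl⟩ <;>
      rcases key b hb hwb with ⟨hwb', rfl | rfl⟩ | ⟨hwb', rfl⟩ <;>
      first | rfl | exact absurd hwa' hwb' | exact absurd hwb' hwa' | skip
    all_goals exact absurd (by simp only [adj_inl_inr, adj_inr_inl]; omega) hab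
  · have hleaf : .inl (2 * m - 3) ∈ T := h.chain.2 _ (by
      obtain ⟨_ | _, _ | _⟩ := κ <;> simp only [IsLeaf, reduceCtorEq] at hκ ⊢ <;> omega)
    have key (x : Label) (hx : x ∈ T) (hwx : labelGraph.Adj w x) :
        w = .inl (2 * m) ∧ (x = .inl (2 * m + 1) ∨ x = .inl (2 * m + 2)) ∨
          w ≠ .inl (2 * m) ∧ x = .inl (2 * m - 3) := by
      have h1 := hT x hx _ hleaf
      have h2 : x ≠ .inl (2 * m) := fun hx' => hnot.2 hκ (hx' ▸ hx)
      have h3 : w = .inr (m - 1) → x ≠ .inl (2 * m - 7) :=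
        fun hw hx' => h.right hκ hw (hx' ▸ hx)
      rcases hw with rfl | rfl | rfl <;> rcases x with x | x <;>
        simp only [adj_inl_inl, adj_inl_inr, adj_inr_inl, adj_inr_inr, Sum.inl.injEq,
          reduceCtorEq, ne_eq, forall_const] at hwx h1 h2 h3 ⊢ <;> grind
    rcases key a ha hwa with ⟨hwa', rfl | rfl⟩ | ⟨hwa', rfl⟩ <;>
      rcases key b hb hwb with ⟨hwb', rfl | rfl⟩ | ⟨hwb', rfl⟩ <;>
      first | rfl | exact absurd hwa' hwb' | exact absurd hwb' hwa' | skip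
    all_goals exact absurd (by simp only [adj_inl_inl]; omega) hab

/-- Two chains on the left that end at the same place have the same hinge. -/
theorem HasChain.not_nested_left {α α' : Bool} (h : HasChain m n (false, α) S T)
    (h' : HasChain m' n' (false, α') S T) (hT : Indep labelGraph T) (hn' : 0 < n')
    (hend : m + 2 * n = m' + 2 * n') (hlt : m < m') : False := by
  have hLL (a b : Label) (ha : IsLeaf m n (false, α) a) (hb : IsLeaf m' n' (false, α') b) :=
    hT a (h.2 a ha) b (h'.2 b hb)
  clear h h' hT
  cases α'
  · have h1 := hLL (.inr m') (.inl (2 * m'))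
    cases α <;> simp only [IsLeaf, adj_inr_inl] at h1 <;> grind
  · have h1 := hLL (.inr (m' - 2)) (.inl (2 * m' - 2))
    have h2 := hLL (.inl (2 * m)) (.inl (2 * m' - 2))
    cases α <;> simp only [IsLeaf, adj_inr_inl, adj_inl_inl] at h1 h2 <;> grind

/-- Two chains on the right that begin at the same place have the same hinge. -/
theorem HasChain.not_nested_right {α α' : Bool} (h : HasChain m n (true, α) S T)
    (h' : HasChain m n' (true, α') S T) (hT : Indep labelGraph T)
    (hlt : n < n') : False := by
  have hLL (a b : Label) (ha : IsLeaf m n (true, α) a) (hb : IsLeaf m n' (true, α') b) :=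
    hT a (h.2 a ha) b (h'.2 b hb)
  clear h h' hT
  cases α
  · have h1 := hLL (.inl (2 * m + 4 * n)) (.inl (2 * m + 4 * n + 1))
    have h2 := hLL (.inl (2 * m + 4 * n)) (.inl (2 * m + 4 * n + 2))
    cases α' <;> simp only [IsLeaf, adj_inl_inl] at h1 h2 <;> grind
  · have h1 := hLL (.inl (2 * m + 4 * n - 2)) (.inl (2 * m + 4 * n - 3))
    cases α' <;> simp only [IsLeaf, adj_inl_inl] at h1 <;> grind

/-- An element does not block the chains of two different fork vertices. -/
theorem Blocks.forkVertex_eq (h : Blocks m n κ S T w) (h' : Blocks m' n' κ' S T w)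
    (hS : Indep labelGraph S) (hT : Indep labelGraph T) :
    forkVertex m n κ.1 = forkVertex m' n' κ'.1 := by
  have hn := h.pos
  have hn' := h'.pos
  have hc := h.chain.zone_cases hS h.pos h.mem h.zone h.notCenter
  have hc' := h'.chain.zone_cases hS h'.pos h'.mem h'.zone h'.notCenter
  have hCC (a b : Label) (ha : IsCenter m n κ.1 a) (hb : IsCenter m' n' κ'.1 b) :=
    hS a (h.chain.1 a ha) b (h'.chain.1 b hb)
  have hLL (a b : Label) (ha : IsLeaf m n κ a) (hb : IsLeaf m' n' κ' b) :=
    hT a (h.chain.2 a ha) b (h'.chain.2 b hb)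
  obtain ⟨s, α⟩ := κ
  obtain ⟨s', α'⟩ := κ'
  have hch := h.chain
  have hch' := h'.chain
  clear h h' hS
  rcases hc with ⟨rfl, hw⟩ | ⟨rfl, hw⟩ <;> rcases hc' with ⟨rfl, hw'⟩ | ⟨rfl, hw'⟩
  · have h1 := hCC (.inl (2 * m + 4 * n - 5)) (.inl (2 * m' + 4 * n' - 5))
      (by simp only [IsCenter]; omega) (by simp only [IsCenter]; omega)
    rw [adj_inl_inl] at h1
    have hend : m + 2 * n = m' + 2 * n' := by
      rcases hw with rfl | rfl | rfl <;> simp only [Sum.inl.injEq] at hw' <;> omega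
    rcases lt_trichotomy m m' with hlt | rfl | hlt
    · exact (hch.not_nested_left hch' hT hn' hend hlt).elim
    · rfl
    · exact (hch'.not_nested_left hch hT hn hend.symm hlt).elim
  · exfalso
    have h1 := hCC (.inl (2 * m + 4 * n - 5)) (.inr (m' + 1))
      (by simp only [IsCenter]; omega) (by simp only [IsCenter]; omega)
    have h2 := hLL (.inr (m + 2 * n)) (.inl (2 * m' - 3))
      (by cases α <;> simp only [IsLeaf] <;> omega) (by cases α' <;> simp only [IsLeaf] <;> omega)
    rw [adj_inl_inr] at h1
    rw [adj_inr_inl] at h2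
    rcases hw with rfl | rfl | rfl <;>
      simp only [Sum.inl.injEq, reduceCtorEq, or_false] at hw' <;> omega
  · exfalso
    have h1 := hCC (.inr (m + 1)) (.inl (2 * m' + 4 * n' - 5))
      (by simp only [IsCenter]; omega) (by simp only [IsCenter]; omega)
    have h2 := hLL (.inl (2 * m - 3)) (.inr (m' + 2 * n'))
      (by cases α <;> simp only [IsLeaf] <;> omega) (by cases α' <;> simp only [IsLeaf] <;> omega)
    rw [adj_inr_inl] at h1
    rw [adj_inl_inr] at h2
    rcases hw' with rfl | rfl | rfl <;>
      simp only [Sum.inl.injEq, reduceCtorEq, or_false] at hw <;> omega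
  · have h1 := hCC (.inr (m + 1)) (.inr (m' + 1))
      (by simp only [IsCenter]; omega) (by simp only [IsCenter]; omega)
    rw [adj_inr_inr] at h1
    obtain rfl : m = m' := by
      rcases hw with rfl | rfl | rfl <;>
        simp only [Sum.inl.injEq, Sum.inr.injEq, reduceCtorEq, or_false, false_or] at hw' <;> omega
    rcases lt_trichotomy n n' with hlt | rfl | hlt
    · exact (hch.not_nested_right hch' hT hlt).elim
    · rfl
    · exact (hch'.not_nested_right hch hT hlt).elim

open Classical in
/-- If two independent sets contain no fork, then on the first one the average degree in
each component of their union is at most `2`. -/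
theorem sum_degree_component_le (hS : Indep labelGraph S) (hT : Indep labelGraph T)
    (hfork : ∀ m n κ, ¬ IsFork m n κ S T) {U : Finset Label} (hSU : S ⊆ U) (hTU : T ⊆ U)
    (c : (restrict labelGraph U).ConnectedComponent) :
    ∑ v ∈ S with component labelGraph U v = c, #{w ∈ T | labelGraph.Adj v w} ≤
      2 * #{v ∈ S | component labelGraph U v = c} := by
  refine sum_degree_le _ _ (fun v w => ∃ m n κ, v = forkVertex m n κ.1 ∧ Blocks m n κ S T w)
    ?_ ?_ ?_ ?_
  · intro v _
    convert (card_neighbors hT v).1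
  · intro v hv h3
    rw [mem_filter] at hv
    obtain ⟨m, κ, rfl, hl⟩ := (card_neighbors hT v).2 (by convert h3)
    have hch : HasChain m 1 κ S T := by
      refine ⟨fun u hu => ?_, hl⟩
      obtain rfl : u = forkVertex m 1 κ.1 := by
        obtain ⟨_ | _, α⟩ := κ <;> rcases u with j | k <;>
          simp only [IsCenter, forkVertex, Sum.inl.injEq, Sum.inr.injEq] at hu ⊢ <;> omega
      exact hv.1
    obtain ⟨m', n', w, hfv, hb⟩ := hch.exists_blocks hT hfork one_pos
    refine ⟨w, mem_filter.2 ⟨hb.mem, ?_⟩, m', n', κ, hfv.symm, hb⟩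
    rw [hb.chain.component_eq hb.pos hSU hTU (hSU hb.mem) (leafZone_of_centerZone hb.zone), hfv]
    exact hv.2
  · rintro v - w - ⟨m, n, κ, -, hb⟩
    refine card_le_one.2 fun a ha b hb' => ?_
    rw [mem_filter] at ha hb'
    exact hb.eq_of_adj hS hT ha.1 hb'.1 ha.2 hb'.2
  · rintro v - v' - w ⟨m, n, κ, rfl, hb⟩ ⟨m', n', κ', rfl, hb'⟩
    exact hb.forkVertex_eq hb' hS hT

end ExtFFD

namespace ExtFFD

open Finset

variable {m m' : ℤ} {n n' : ℕ} {s s' : Bool} {κ κ' κ'' : Bool × Bool} {u v w : Label}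
  {S T : Finset Label}

/-! ### Replacing the chain of a fork -/

/-- Replace the parts of `S` and `T` in the zones at position `(m, n)` by the chain of kind `κ`. -/
def replaceChain (m : ℤ) (n : ℕ) (κ : Bool × Bool) (p : Finset Label × Finset Label) :
    Finset Label × Finset Label :=
  ({v ∈ p.1 | ¬ CenterZone m n v} ∪ chainCenters m n κ.1,
    {v ∈ p.2 | ¬ LeafZone m n v} ∪ chainLeaves m n κ)

theorem mem_replaceChain_fst {p : Finset Label × Finset Label} :
    v ∈ (replaceChain m n κ p).1 ↔ v ∈ p.1 ∧ ¬ CenterZone m n v ∨ IsCenter m n κ.1 v := by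
  simp [replaceChain, mem_chainCenters]

theorem mem_replaceChain_snd {p : Finset Label × Finset Label} :
    v ∈ (replaceChain m n κ p).2 ↔ v ∈ p.2 ∧ ¬ LeafZone m n v ∨ IsLeaf m n κ v := by
  simp [replaceChain, mem_chainLeaves]

theorem disjoint_center : Disjoint {v ∈ S | ¬ CenterZone m n v} (chainCenters m n s) := by
  rw [disjoint_left]
  intro v hv hv'
  exact (mem_filter.1 hv).2 (centerZone_of_isCenter (mem_chainCenters.1 hv'))

theorem disjoint_leaf (hn : 0 < n) : Disjoint {v ∈ T | ¬ LeafZone m n v} (chainLeaves m n κ) := by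
  rw [disjoint_left]
  intro v hv hv'
  exact (mem_filter.1 hv).2 (leafZone_of_isLeaf hn (mem_chainLeaves.1 hv'))

theorem indep_replace_center (hS : Indep labelGraph S) :
    Indep labelGraph ({v ∈ S | ¬ CenterZone m n v} ∪ chainCenters m n s) := by
  intro u hu v hv huv
  rw [mem_union, mem_filter] at hu hv
  rcases hu with hu | hu <;> rcases hv with hv | hv
  · exact hS u hu.1 v hv.1 huv
  · exact hu.2 (centerZone_of_adj (mem_chainCenters.1 hv) huv)
  · exact hv.2 (centerZone_of_adj (mem_chainCenters.1 hu) huv.symm)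
  · exact indep_chainCenters u hu v hv huv

theorem indep_replace_leaf (hn : 0 < n) (hT : Indep labelGraph T) :
    Indep labelGraph ({v ∈ T | ¬ LeafZone m n v} ∪ chainLeaves m n κ) := by
  intro u hu v hv huv
  rw [mem_union, mem_filter] at hu hv
  rcases hu with hu | hu <;> rcases hv with hv | hv
  · exact hT u hu.1 v hv.1 huv
  · exact hu.2 (leafZone_of_adj hn (mem_chainLeaves.1 hv) huv)
  · exact hv.2 (leafZone_of_adj hn (mem_chainLeaves.1 hu) huv.symm)
  · exact indep_chainLeaves u hu v hv huv

theorem card_hinge {b : Bool} : #(hinge m b) = 2 := by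
  cases b
  · exact card_pair (by simp; omega)
  · exact card_pair (by simp)

theorem disjoint_hinge : Disjoint (hinge (hingePos m n κ.1) κ.2) (chainEnds m n κ.1) := by
  rw [disjoint_left]
  obtain ⟨_ | _, _ | _⟩ := κ <;> rintro (j | k) h h' <;>
    simp only [hinge, hingePos, chainEnds, mem_insert, mem_singleton, mem_image_range_inl,
      mem_image_range_inr, inl_notMem_image, inr_notMem_image, Sum.inl.injEq, Sum.inr.injEq,
      reduceCtorEq, or_false, false_or] at h h' <;> omega

theorem card_chainEnds : #(chainEnds m n s) = n := by
  cases s <;> unfold chainEnds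
  · rw [card_image_of_injective _ fun i j h => by simpa using h, card_range]
  · rw [card_image_of_injective _ fun i j h => by simpa using h, card_range]

theorem card_chainLeaves : #(chainLeaves m n κ) = 2 + n := by
  rw [chainLeaves, card_union_of_disjoint disjoint_hinge, card_hinge, card_chainEnds]

theorem IsFork.replaceChain_self {p : Finset Label × Finset Label} (h : IsFork m n κ p.1 p.2) :
    replaceChain m n κ p = p := by
  refine Prod.ext (ext fun v => ?_) (ext fun v => ?_)
  · rw [mem_replaceChain_fst]
    have := h.center v
    have := @centerZone_of_isCenter m n κ.1 v
    tauto
  · rw [mem_replaceChain_snd]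
    have := h.leaf v
    have := @leafZone_of_isLeaf m n κ v h.pos
    tauto

theorem replaceChain_replaceChain (hn : 0 < n) {p : Finset Label × Finset Label} :
    replaceChain m n κ (replaceChain m n κ' p) = replaceChain m n κ p := by
  refine Prod.ext (ext fun v => ?_) (ext fun v => ?_)
  · rw [mem_replaceChain_fst, mem_replaceChain_fst, mem_replaceChain_fst]
    have := @centerZone_of_isCenter m n κ'.1 v
    tauto
  · rw [mem_replaceChain_snd, mem_replaceChain_snd, mem_replaceChain_snd]
    have := @leafZone_of_isLeaf m n κ' v hn
    tauto

theorem isFork_replaceChain (hn : 0 < n) {p : Finset Label × Finset Label} :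
    IsFork m n κ (replaceChain m n κ p).1 (replaceChain m n κ p).2 := by
  refine ⟨hn, fun v hv => ?_, fun v hv => ?_⟩
  · rw [mem_replaceChain_fst]
    tauto
  · rw [mem_replaceChain_snd]
    tauto

theorem IsFork.card_fst {p : Finset Label × Finset Label} (h : IsFork m n κ p.1 p.2) :
    #(replaceChain m n κ' p).1 = #p.1 := by
  conv_rhs => rw [← h.replaceChain_self]
  rw [replaceChain, replaceChain, card_union_of_disjoint disjoint_center,
    card_union_of_disjoint disjoint_center, card_chainCenters, card_chainCenters]

theorem IsFork.card_snd {p : Finset Label × Finset Label} (h : IsFork m n κ p.1 p.2) :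
    #(replaceChain m n κ' p).2 = #p.2 := by
  conv_rhs => rw [← h.replaceChain_self]
  rw [replaceChain, replaceChain, card_union_of_disjoint (disjoint_leaf h.pos),
    card_union_of_disjoint (disjoint_leaf h.pos), card_chainLeaves, card_chainLeaves]

/-- The kind of a fork is determined by its position. -/
theorem IsFork.kind_eq (h : IsFork m n κ S T) (h' : IsFork m n κ' S T) : κ = κ' := by
  have hn := h.pos
  have hC v hv := (h.center v hv).symm.trans (h'.center v hv)
  have hL v hv := (h.leaf v hv).symm.trans (h'.leaf v hv)
  have h1 := hC (.inl (2 * m - 1))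
  have h2 := hL (.inl (2 * m))
  have h3 := hL (.inl (2 * m + 4 * n))
  clear h h' hC hL
  obtain ⟨_ | _, _ | _⟩ := κ <;> obtain ⟨_ | _, _ | _⟩ := κ' <;>
    simp only [IsCenter, IsLeaf, CenterZone, LeafZone] at h1 h2 h3 ⊢ <;> grind

/-! ### Moves at one position do not affect the forks at another -/

theorem IsFork.far (h : IsFork m n κ S T) (h' : IsFork m' n' κ' S T)
    (hne : ¬ (m = m' ∧ n = n')) : m + 2 * n + 3 ≤ m' ∨ m' + 2 * n' + 3 ≤ m := by
  by_contra hcon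
  refine hne ?_
  rcases le_total m m' with hle | hle
  · exact eq_of_agree h.pos h'.pos hle (by omega)
      (fun v hv hv' => (h.center v hv).symm.trans (h'.center v hv'))
      fun v hv hv' => (h.leaf v hv).symm.trans (h'.leaf v hv')
  · obtain ⟨h1, h2⟩ := eq_of_agree h'.pos h.pos hle (by omega)
      (fun v hv hv' => (h'.center v hv).symm.trans (h.center v hv'))
      fun v hv hv' => (h'.leaf v hv).symm.trans (h.leaf v hv')
    exact ⟨h1.symm, h2.symm⟩

theorem IsFork.far_swap (h : IsFork m n κ S T) (h' : IsFork m' n' κ' T S) :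
    m + 2 * n + 2 ≤ m' ∨ m' + 2 * n' + 2 ≤ m := by
  by_contra hcon
  rcases le_total m m' with hle | hle
  · exact false_of_agree_swap h.pos h'.pos hle (by omega)
      (fun v hv hv' => (h.center v hv).symm.trans (h'.leaf v hv'))
      fun v hv hv' => (h.leaf v hv).symm.trans (h'.center v hv')
  · exact false_of_agree_swap h'.pos h.pos hle (by omega)
      (fun v hv hv' => (h'.center v hv).symm.trans (h.leaf v hv'))
      fun v hv hv' => (h'.leaf v hv).symm.trans (h.center v hv')

theorem IsFork.mem_replaceChain_fst_iff {p : Finset Label × Finset Label}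
    (h : IsFork m n κ p.1 p.2) (hv : ∀ s, ¬ IsCenter m n s v) :
    v ∈ (replaceChain m n κ' p).1 ↔ v ∈ p.1 := by
  rw [mem_replaceChain_fst]
  have := h.center v
  have := hv κ.1
  have := hv κ'.1
  tauto

theorem IsFork.mem_replaceChain_snd_iff {p : Finset Label × Finset Label}
    (h : IsFork m n κ p.1 p.2) (hv : ∀ κ, ¬ IsLeaf m n κ v) :
    v ∈ (replaceChain m n κ' p).2 ↔ v ∈ p.2 := by
  rw [mem_replaceChain_snd]
  have := h.leaf v
  have := hv κ
  have := hv κ'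
  tauto

/-- Replacing the chain of a fork creates no fork at another position. -/
theorem IsFork.of_replaceChain {p : Finset Label × Finset Label} (h : IsFork m n κ p.1 p.2)
    (h' : IsFork m' n' κ'' (replaceChain m n κ' p).1 (replaceChain m n κ' p).2)
    (hne : ¬ (m = m' ∧ n = n')) : IsFork m' n' κ'' p.1 p.2 := by
  have hfar := (isFork_replaceChain h.pos).far h' hne
  have hn := h.pos
  have hn' := h'.pos
  refine ⟨h'.pos, fun v hv => ?_, fun v hv => ?_⟩
  · rw [← h'.center v hv, h.mem_replaceChain_fst_iff]
    intro s hs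
    rcases s <;> rcases v with j | k <;> simp only [IsCenter, CenterZone] at hs hv <;> omega
  · rw [← h'.leaf v hv, h.mem_replaceChain_snd_iff]
    intro κ hs
    rcases κ with ⟨_ | _, _ | _⟩ <;> rcases v with j | k <;>
      simp only [IsLeaf, LeafZone] at hs hv <;> omega

/-- Replacing the chain of a fork creates no fork with interchanged roles of the two sets. -/
theorem IsFork.of_replaceChain_swap {p : Finset Label × Finset Label} (h : IsFork m n κ p.1 p.2)
    (h' : IsFork m' n' κ'' (replaceChain m n κ' p).2 (replaceChain m n κ' p).1) :
    IsFork m' n' κ'' p.2 p.1 := by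
  have hfar := (isFork_replaceChain h.pos).far_swap h'
  have hn := h.pos
  have hn' := h'.pos
  refine ⟨h'.pos, fun v hv => ?_, fun v hv => ?_⟩
  · rw [← h'.center v hv, h.mem_replaceChain_snd_iff]
    intro κ hs
    rcases κ with ⟨_ | _, _ | _⟩ <;> rcases v with j | k <;>
      simp only [IsLeaf, CenterZone] at hs hv <;> omega
  · rw [← h'.leaf v hv, h.mem_replaceChain_fst_iff]
    intro s hs
    rcases s <;> rcases v with j | k <;> simp only [IsCenter, LeafZone] at hs hv <;> omega

/-! ### Pairs with forks do not contribute -/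

/-- The pair itself, or the pair with its two sets interchanged. -/
def orient (b : Bool) (p : Finset Label × Finset Label) : Finset Label × Finset Label :=
  if b then p.swap else p

theorem orient_orient (b : Bool) (p : Finset Label × Finset Label) : orient b (orient b p) = p := by
  cases b <;> rfl

/-- The pair has a fork at the site `(m, n, b)`; the Boolean says which of the two sets
contains the centres. -/
def HasFork (x : ℤ × ℕ × Bool) (p : Finset Label × Finset Label) : Prop :=
  ∃ κ, IsFork x.1 x.2.1 κ (orient x.2.2 p).1 (orient x.2.2 p).2

/-- Replace the chain at the site `(m, n, b)`. -/
def moveFork (x : ℤ × ℕ × Bool) (κ : Bool × Bool) (p : Finset Label × Finset Label) :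
    Finset Label × Finset Label :=
  orient x.2.2 (replaceChain x.1 x.2.1 κ (orient x.2.2 p))

variable {x y : ℤ × ℕ × Bool} {p : Finset Label × Finset Label}

theorem HasFork.of_moveFork (h : HasFork x p) (h' : HasFork y (moveFork x κ p)) (hne : x ≠ y) :
    HasFork y p := by
  obtain ⟨m, n, b⟩ := x
  obtain ⟨m', n', b'⟩ := y
  obtain ⟨κ₁, h⟩ := h
  obtain ⟨κ₂, h'⟩ := h'
  refine ⟨κ₂, ?_⟩
  cases b <;> cases b'
  · exact IsFork.of_replaceChain h h' fun h => hne (Prod.ext h.1 (Prod.ext h.2 rfl))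
  · exact IsFork.of_replaceChain_swap h h'
  · exact IsFork.of_replaceChain_swap (p := p.swap) h h'
  · exact IsFork.of_replaceChain (p := p.swap) h h' fun h => hne (Prod.ext h.1 (Prod.ext h.2 rfl))

theorem HasFork.hasFork_moveFork (h : HasFork x p) (κ : Bool × Bool) :
    IsFork x.1 x.2.1 κ (orient x.2.2 (moveFork x κ p)).1 (orient x.2.2 (moveFork x κ p)).2 := by
  obtain ⟨κ₁, h⟩ := h
  rw [moveFork, orient_orient]
  exact isFork_replaceChain h.pos

theorem moveFork_moveFork
    (hκ : IsFork x.1 x.2.1 κ (orient x.2.2 p).1 (orient x.2.2 p).2) :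
    moveFork x κ (moveFork x κ' p) = p := by
  rw [moveFork, moveFork, orient_orient, replaceChain_replaceChain hκ.pos, hκ.replaceChain_self,
    orient_orient]

open Classical in
/-- If the values of `F` on the variants of a pair with a fork always cancel, then only the pairs
without forks contribute to the sum of `F`. -/
theorem sum_without_forks {A : Type*} [AddCommMonoid A] (Q : Finset (Finset Label × Finset Label))
    (F : Finset Label × Finset Label → A) (X : Finset (ℤ × ℕ × Bool))
    (hQ : ∀ x ∈ X, ∀ p ∈ Q, HasFork x p → ∀ κ, moveFork x κ p ∈ Q)
    (hF : ∀ x ∈ X, ∀ p ∈ Q, HasFork x p → ∑ κ, F (moveFork x κ p) = 0) :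
    ∑ p ∈ Q with ∀ x ∈ X, ¬ HasFork x p, F p = ∑ p ∈ Q, F p := by
  induction X using Finset.induction_on with
  | empty => simp
  | insert x X hx ih =>
    rw [← ih (fun y hy => hQ y (mem_insert_of_mem hy)) fun y hy => hF y (mem_insert_of_mem hy),
      ← sum_filter_add_sum_filter_not ({p ∈ Q | ∀ y ∈ X, ¬ HasFork y p}) (fun p => HasFork x p)]
    have h0 : ∑ p ∈ {p ∈ Q | ∀ y ∈ X, ¬ HasFork y p} with HasFork x p, F p = 0 := by
      refine sum_eq_zero_of_moves _ F
        (fun κ p => IsFork x.1 x.2.1 κ (orient x.2.2 p).1 (orient x.2.2 p).2) (moveFork x)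
        ?_ ?_ ?_ ?_ ?_
      · exact fun p hp => (mem_filter.1 hp).2
      · exact fun κ κ' p h h' => h.kind_eq h'
      · intro p hp κ
        rw [filter_filter, mem_filter] at hp
        refine ⟨?_, hp.2.2.hasFork_moveFork κ⟩
        rw [filter_filter, mem_filter]
        refine ⟨hQ x (mem_insert_self _ _) p hp.1 hp.2.2 κ, fun y hy hfork => ?_,
          κ, hp.2.2.hasFork_moveFork κ⟩
        exact hp.2.1 y hy (hp.2.2.of_moveFork hfork fun h => hx (h ▸ hy))
      · exact fun p _ κ κ' hκ => moveFork_moveFork hκ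
      · intro p hp
        rw [filter_filter, mem_filter] at hp
        exact hF x (mem_insert_self _ _) p hp.1 hp.2.2
    rw [h0, zero_add, filter_filter]
    refine sum_congr (filter_congr fun p _ => ?_) fun _ _ => rfl
    rw [forall_mem_insert]
    tauto

end ExtFFD

namespace ExtFFD

open Finset

variable {m : ℤ} {n : ℕ} {s : Bool} {κ κ' : Bool × Bool} {S T : Finset Label}
  {A : Type*} [Ring A] {h : Label → A}

/-! ### The products of the centres and leaves of chains -/

/-- The element `A_{2m-1}`, the sum of the two possible products over a hinge. -/
def hingeElement (h : Label → A) (m : ℤ) : A :=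
  h (.inl (2 * m)) * h (.inl (2 * m - 3)) + h (.inl (2 * m - 2)) * h (.inr m)

/-- The element `C_{2m}`. Up to sign, a chain grows by a factor of this form when `n` increases
by one. -/
def linkElement (h : Label → A) (m : ℤ) : A := h (.inl (2 * m - 3)) * h (.inr (m + 1))

/-- A family of elements with the commutation relations of the frustration graph that satisfies the
relations `A_{2m-1} C_{2m+2} = C_{2m} A_{2m+3}` for all `m`. -/
structure IsFFDFamily (h : Label → A) : Prop where
  frustrated : IsFrustratedBy labelGraph h
  hinge_mul_link (m : ℤ) :
    hingeElement h m * linkElement h (m + 1) = linkElement h m * hingeElement h (m + 2)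

theorem indep_hinge {b : Bool} : Indep labelGraph (hinge m b) :=
  (indep_chainLeaves (m := m) (n := 0) (κ := (false, b))).subset subset_union_left

theorem indep_chainEnds : Indep labelGraph (chainEnds m n s) :=
  (indep_chainLeaves (κ := (s, false))).subset subset_union_right

theorem IsFrustratedBy.sum_monomial_hinge (hG : IsFrustratedBy labelGraph h) (m : ℤ) :
    ∑ b, monomial h (hinge m b) = hingeElement h m := by
  have h1 : monomial h (hinge m false) = h (.inl (2 * m)) * h (.inl (2 * m - 3)) := by
    have hind := indep_hinge (m := m) (b := false)
    rw [hinge] at hind ⊢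
    rw [hG.monomial_insert hind (by simp; omega), monomial_singleton]
  have h2 : monomial h (hinge m true) = h (.inl (2 * m - 2)) * h (.inr m) := by
    have hind := indep_hinge (m := m) (b := true)
    rw [hinge] at hind ⊢
    rw [hG.monomial_insert hind (by simp), monomial_singleton]
  rw [Fintype.sum_bool, h1, h2, add_comm, hingeElement]

theorem IsFrustratedBy.monomial_insert_right {ι : Type*} [DecidableEq ι] {G : SimpleGraph ι}
    {h : ι → A} (hG : IsFrustratedBy G h) {v : ι} {S : Finset ι} (hS : Indep G (insert v S))
    (hv : v ∉ S) : monomial h (insert v S) = monomial h S * h v := by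
  rw [hG.monomial_insert hS hv]
  exact commute_monomial fun w hw =>
    hG.commute (hS v (mem_insert_self _ _) w (mem_insert_of_mem hw))

theorem IsFrustratedBy.monomial_centers_succ (hG : IsFrustratedBy labelGraph h) :
    monomial h (chainCenters m (n + 1) s) = monomial h (chainCenters m n s) *
      h (match s with | false => .inl (2 * m - 1 + 4 * n) | true => .inr (m + 1 + 2 * n)) := by
  have hind := indep_chainCenters (m := m) (n := n + 1) (s := s)
  cases s <;> simp only [chainCenters, range_add_one, image_insert] at hind ⊢ <;>
    refine hG.monomial_insert_right hind ?_
  · rw [mem_image_range_inl]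
    omega
  · rw [mem_image_range_inr]
    omega

theorem IsFrustratedBy.monomial_ends_succ (hG : IsFrustratedBy labelGraph h) :
    monomial h (chainEnds m (n + 1) s) = monomial h (chainEnds m n s) *
      h (match s with | false => .inr (m + 2 + 2 * n) | true => .inl (2 * m - 3 + 4 * n)) := by
  have hind := indep_chainEnds (m := m) (n := n + 1) (s := s)
  cases s <;> simp only [chainEnds, range_add_one, image_insert] at hind ⊢ <;>
    refine hG.monomial_insert_right hind ?_
  · rw [mem_image_range_inr]
    omega
  · rw [mem_image_range_inl]
    omega

theorem commute_mul_of_anticommute {a b c : A} (hb : a * b = -(b * a)) (hc : a * c = -(c * a)) :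
    Commute a (b * c) := by
  change a * (b * c) = b * c * a
  rw [← mul_assoc, hb, neg_mul, mul_assoc, hc, mul_neg, neg_neg, mul_assoc]

/-- A label that is adjacent to both or none of the elements of each pair commutes with
`A_{2m-1}`. -/
theorem IsFrustratedBy.commute_hingeElement (hG : IsFrustratedBy labelGraph h) {v : Label}
    (h1 : labelGraph.Adj v (.inl (2 * m)) ↔ labelGraph.Adj v (.inl (2 * m - 3)))
    (h2 : labelGraph.Adj v (.inl (2 * m - 2)) ↔ labelGraph.Adj v (.inr m)) :
    Commute (h v) (hingeElement h m) := by
  have key {a b : Label} (hab : labelGraph.Adj v a ↔ labelGraph.Adj v b) :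
      Commute (h v) (h a * h b) := by
    by_cases ha : labelGraph.Adj v a
    · exact commute_mul_of_anticommute (hG.anticommute ha) (hG.anticommute (hab.1 ha))
    · exact (hG.commute ha).mul_right (hG.commute (mt hab.2 ha))
  exact (key h1).add_right (key h2)

theorem IsFrustratedBy.link_comm (hG : IsFrustratedBy labelGraph h) (m : ℤ) :
    h (.inr (m + 1)) * h (.inl (2 * m - 3)) = -linkElement h m :=
  hG.anticommute (by rw [adj_inr_inl]; omega)

/-- Prolonging a chain with the hinge on the right by one link multiplies its product, summed over
the two hinges, by `-C_{2k}` with `k = m + 2 n + 1`: the relation `A C = C A` moves the hinge to the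
new position. -/
theorem IsFFDFamily.right_succ (hF : IsFFDFamily h) (m : ℤ) (n : ℕ) :
    monomial h (chainCenters m (n + 1) true) * (monomial h (chainEnds m (n + 1) true) *
        hingeElement h (m + 2 * (n + 1 : ℕ))) =
      -(monomial h (chainCenters m n true) * (monomial h (chainEnds m n true) *
        hingeElement h (m + 2 * n)) * linkElement h (m + 2 * n + 1)) := by
  have hG := hF.frustrated
  have hc : Commute (h (.inr (m + 1 + 2 * n))) (monomial h (chainEnds m n true)) := by
    refine commute_monomial fun v hv => hG.commute ?_
    unfold chainEnds at hv
    rcases v with j | k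
    · rw [mem_image_range_inl] at hv
      rw [adj_inr_inl]
      omega
    · exact absurd hv inr_notMem_image
  have hl := hG.link_comm (m + 2 * n)
  have hac := hF.hinge_mul_link (m + 2 * n)
  rw [show 2 * (m + 2 * (n : ℤ)) - 3 = 2 * m - 3 + 4 * n by ring,
    show m + 2 * (n : ℤ) + 1 = m + 1 + 2 * n by ring] at hl
  rw [hG.monomial_centers_succ, hG.monomial_ends_succ,
    show m + 2 * ((n + 1 : ℕ) : ℤ) = m + 2 * n + 2 by push_cast; ring]
  simp only [mul_assoc]
  rw [hac, ← mul_assoc (h (.inr _)), hc.eq]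
  simp only [mul_assoc]
  rw [← mul_assoc (h (.inr _)), hl]
  simp only [neg_mul, mul_neg]

/-- The sum over the two chains of length one with the hinge on the left is the left-hand side of
the relation `A_{2m-1} C_{2m+2} = C_{2m} A_{2m+3}`. -/
theorem IsFFDFamily.left_one (hF : IsFFDFamily h) (m : ℤ) :
    monomial h (chainCenters m 1 false) * (hingeElement h m * monomial h (chainEnds m 1 false)) =
      hingeElement h m * linkElement h (m + 1) := by
  have hG := hF.frustrated
  have hc : Commute (h (.inl (2 * m - 1))) (hingeElement h m) :=
    hG.commute_hingeElement (by simp only [adj_inl_inl]; omega)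
      (iff_of_true (by rw [adj_inl_inl]; omega) (by rw [adj_inl_inr]; omega))
  have h1 : chainCenters m 1 false = {.inl (2 * m - 1)} := by simp [chainCenters]
  have h2 : chainEnds m 1 false = {.inr (m + 2)} := by simp [chainEnds]
  rw [h1, h2, monomial_singleton, monomial_singleton, ← mul_assoc, hc.eq, mul_assoc, linkElement,
    show 2 * (m + 1) - 3 = 2 * m - 1 by ring, show m + 1 + 1 = m + 2 by ring]

/-- Prolonging a chain with the hinge on the left by one link multiplies its product by the same
factor as for the hinge on the right. -/
theorem IsFFDFamily.left_succ (hF : IsFFDFamily h) (m : ℤ) (n : ℕ) :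
    monomial h (chainCenters m (n + 2) false) *
        (hingeElement h m * monomial h (chainEnds m (n + 2) false)) =
      -(monomial h (chainCenters m (n + 1) false) * (hingeElement h m *
        monomial h (chainEnds m (n + 1) false)) * linkElement h (m + 2 * (n + 1 : ℕ) + 1)) := by
  have hG := hF.frustrated
  have hc : Commute (h (.inl (2 * m - 1 + 4 * (n + 1 : ℕ)))) (hingeElement h m) :=
    hG.commute_hingeElement (by simp only [adj_inl_inl]; omega)
      (by simp only [adj_inl_inl, adj_inl_inr]; omega)
  have hc' : Commute (h (.inl (2 * m - 1 + 4 * (n + 1 : ℕ))))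
      (monomial h (chainEnds m n false)) := by
    refine commute_monomial fun v hv => hG.commute ?_
    unfold chainEnds at hv
    rcases v with j | k
    · exact absurd hv inl_notMem_image
    · rw [mem_image_range_inr] at hv
      rw [adj_inl_inr]
      omega
  have ha : h (.inl (2 * m - 1 + 4 * (n + 1 : ℕ))) * h (.inr (m + 2 + 2 * n)) =
      -(h (.inr (m + 2 + 2 * n)) * h (.inl (2 * m - 1 + 4 * (n + 1 : ℕ)))) :=
    hG.anticommute (by rw [adj_inl_inr]; omega)
  rw [hG.monomial_centers_succ, hG.monomial_ends_succ (n := n + 1), hG.monomial_ends_succ,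
    linkElement,
    show 2 * (m + 2 * ((n + 1 : ℕ) : ℤ) + 1) - 3 = 2 * m - 1 + 4 * (n + 1 : ℕ) by ring,
    show m + 2 * ((n + 1 : ℕ) : ℤ) + 1 + 1 = m + 2 + 2 * (n + 1 : ℕ) by ring]
  simp only [mul_assoc]
  rw [← mul_assoc _ (hingeElement h m), hc.eq]
  simp only [mul_assoc]
  rw [← mul_assoc _ (monomial h (chainEnds m n false)), hc'.eq]
  simp only [mul_assoc]
  rw [← mul_assoc _ (h (.inr (m + 2 + 2 * n))), ha]
  simp only [neg_mul, mul_neg, mul_assoc]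

/-- The contributions of the four kinds of chains at one position cancel. By induction on the
length, the two with the hinge on the left are the negative of the two with the hinge on the
right; for length one this is the relation `A_{2m-1} C_{2m+2} = C_{2m} A_{2m+3}`. -/
theorem IsFFDFamily.sum_chains (hF : IsFFDFamily h) (hn : 0 < n) :
    ∑ κ : Bool × Bool, monomial h (chainCenters m n κ.1) * monomial h (chainLeaves m n κ) = 0 := by
  have hG := hF.frustrated
  have h1 : ∑ b, monomial h (chainLeaves m n (false, b)) =
      hingeElement h m * monomial h (chainEnds m n false) := by
    rw [← hG.sum_monomial_hinge, sum_mul]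
    exact sum_congr rfl fun b _ => hG.monomial_union indep_chainLeaves disjoint_hinge
  have h2 : ∑ b, monomial h (chainLeaves m n (true, b)) =
      monomial h (chainEnds m n true) * hingeElement h (m + 2 * n) := by
    rw [← hG.sum_monomial_hinge, mul_sum]
    refine sum_congr rfl fun b _ => ?_
    have hind := indep_chainLeaves (m := m) (n := n) (κ := (true, b))
    rw [chainLeaves, union_comm] at hind ⊢
    exact hG.monomial_union hind disjoint_hinge.symm
  rw [Fintype.sum_prod_type, Fintype.sum_bool]
  simp only [← mul_sum, h1, h2]
  obtain ⟨n, rfl⟩ : ∃ k, n = k + 1 := ⟨n - 1, by omega⟩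
  clear hn h1 h2
  induction n with
  | zero =>
    have := hF.right_succ m 0
    rw [this]
    simp only [zero_add, hF.left_one]
    simp [chainCenters, chainEnds, monomial_empty]
  | succ n ih =>
    rw [hF.right_succ, hF.left_succ, ← neg_add, ← add_mul, ih, zero_mul, neg_zero]

/-! ### The reverse order of the factors -/

open MulOpposite in
theorem IsFrustratedBy.opposite {ι : Type*} {G : SimpleGraph ι} {h : ι → A}
    (hG : IsFrustratedBy G h) : IsFrustratedBy G fun v => op (h v) where
  commute huv := (hG.commute huv).op
  anticommute huv := by
    rw [← op_mul, ← op_mul, ← op_neg, hG.anticommute huv.symm]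

open MulOpposite in
theorem IsFrustratedBy.monomial_op {ι : Type*} [DecidableEq ι] {G : SimpleGraph ι} {h : ι → A}
    (hG : IsFrustratedBy G h) {S : Finset ι} (hS : Indep G S) :
    monomial (fun v => op (h v)) S = op (monomial h S) := by
  induction S using Finset.induction_on with
  | empty => simp [monomial_empty]
  | insert v S hv ih =>
    rw [hG.opposite.monomial_insert hS hv, hG.monomial_insert_right hS hv,
      ih (hS.subset (subset_insert _ _)), op_mul]

open MulOpposite in
/-- The relations are invariant under reversing the order of multiplication: `C_{2m}` changes its
sign, but it occurs once on either side, and it commutes with the neighbouring hinges. -/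
theorem IsFFDFamily.opposite (hF : IsFFDFamily h) : IsFFDFamily fun v => op (h v) where
  frustrated := hF.frustrated.opposite
  hinge_mul_link m := by
    have hG := hF.frustrated
    have h1 (m : ℤ) : hingeElement (fun v => op (h v)) m = op (hingeElement h m) := by
      have c1 : Commute (h (.inl (2 * m))) (h (.inl (2 * m - 3))) :=
        hG.commute (by rw [adj_inl_inl]; omega)
      have c2 : Commute (h (.inl (2 * m - 2))) (h (.inr m)) :=
        hG.commute (by rw [adj_inl_inr]; omega)
      rw [hingeElement, hingeElement, op_add, c1.eq, c2.eq, op_mul, op_mul]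
    have h2 (m : ℤ) : linkElement (fun v => op (h v)) m = -op (linkElement h m) := by
      rw [linkElement, ← op_mul, hG.link_comm, op_neg]
    have h3 : Commute (hingeElement h m) (linkElement h (m + 1)) := by
      refine .mul_right (.symm ?_) (.symm ?_) <;> refine hG.commute_hingeElement ?_ ?_ <;>
        simp only [adj_inl_inl, adj_inl_inr, adj_inr_inl, adj_inr_inr] <;> omega
    have h4 : Commute (linkElement h m) (hingeElement h (m + 2)) := by
      refine .mul_left ?_ ?_ <;> refine hG.commute_hingeElement ?_ ?_ <;>
        simp only [adj_inl_inl, adj_inl_inr, adj_inr_inl, adj_inr_inr] <;> omega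
    rw [h1, h1, h2, h2, mul_neg, neg_mul, ← op_mul, ← op_mul, ← h3.eq, ← h4.eq, hF.hinge_mul_link]

theorem IsFFDFamily.sum_chains_reverse (hF : IsFFDFamily h) (hn : 0 < n) :
    ∑ κ : Bool × Bool, monomial h (chainLeaves m n κ) * monomial h (chainCenters m n κ.1) = 0 := by
  apply MulOpposite.op_injective
  rw [Finset.op_sum, MulOpposite.op_zero, ← hF.opposite.sum_chains (m := m) hn]
  refine sum_congr rfl fun κ _ => ?_
  rw [MulOpposite.op_mul, hF.frustrated.monomial_op indep_chainCenters,
    hF.frustrated.monomial_op indep_chainLeaves]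

/-- The contributions of the four variants of a pair with a fork cancel, in either order
of multiplication. -/
theorem IsFFDFamily.sum_replaceChain (hF : IsFFDFamily h) (hn : 0 < n)
    (hS : Indep labelGraph S) (hT : Indep labelGraph T) :
    ∑ κ, monomial h (replaceChain m n κ (S, T)).1 * monomial h (replaceChain m n κ (S, T)).2 = 0 ∧
      ∑ κ, monomial h (replaceChain m n κ (S, T)).2 * monomial h (replaceChain m n κ (S, T)).1 =
        0 := by
  have hG := hF.frustrated
  -- Outside the leaf zone, the elements of `T` are not adjacent to any centre.
  have hc (κ : Bool × Bool) : Commute (monomial h (chainCenters m n κ.1))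
      (monomial h {v ∈ T | ¬ LeafZone m n v}) := by
    refine hG.commute_monomials fun u hu v hv huv => (mem_filter.1 hv).2 ?_
    exact leafZone_of_centerZone (centerZone_of_adj (mem_chainCenters.1 hu) huv.symm)
  have hcS (κ : Bool × Bool) : Commute (monomial h {v ∈ S | ¬ CenterZone m n v})
      (monomial h (chainCenters m n κ.1)) :=
    hG.commute_monomials fun u hu v hv => indep_replace_center (s := κ.1) hS u
      (mem_union_left _ hu) v (mem_union_right _ hv)
  have h1 (κ : Bool × Bool) := hG.monomial_union (indep_replace_center (m := m) (n := n)
    (s := κ.1) hS) disjoint_center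
  have h2 (κ : Bool × Bool) := hG.monomial_union (indep_replace_leaf (m := m) (κ := κ) hn hT)
    (disjoint_leaf hn)
  simp only [replaceChain, h1, h2]
  constructor
  · have key (κ : Bool × Bool) :
        monomial h {v ∈ S | ¬ CenterZone m n v} * monomial h (chainCenters m n κ.1) *
          (monomial h {v ∈ T | ¬ LeafZone m n v} * monomial h (chainLeaves m n κ)) =
        monomial h {v ∈ S | ¬ CenterZone m n v} * monomial h {v ∈ T | ¬ LeafZone m n v} *
          (monomial h (chainCenters m n κ.1) * monomial h (chainLeaves m n κ)) := by
      rw [mul_assoc, ← mul_assoc _ _ (monomial h (chainLeaves m n κ)), (hc κ).eq]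
      simp only [mul_assoc]
    rw [sum_congr rfl fun κ _ => key κ, ← mul_sum, hF.sum_chains hn, mul_zero]
  · have key (κ : Bool × Bool) :
        monomial h {v ∈ T | ¬ LeafZone m n v} * monomial h (chainLeaves m n κ) *
          (monomial h {v ∈ S | ¬ CenterZone m n v} * monomial h (chainCenters m n κ.1)) =
        monomial h {v ∈ T | ¬ LeafZone m n v} *
          (monomial h (chainLeaves m n κ) * monomial h (chainCenters m n κ.1)) *
          monomial h {v ∈ S | ¬ CenterZone m n v} := by
      rw [(hcS κ).eq]
      simp only [mul_assoc]
    rw [sum_congr rfl fun κ _ => key κ, ← sum_mul, ← mul_sum, hF.sum_chains_reverse hn, mul_zero,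
      zero_mul]

end ExtFFD

namespace ExtFFD

open Finset

variable {m : ℤ} {n : ℕ} {κ κ' : Bool × Bool} {S T V : Finset Label}

/-! ### The charges commute -/

open Classical in
/-- The independent subsets of `V` with `k` elements. -/
noncomputable def indepSubsets (V : Finset Label) (k : ℕ) : Finset (Finset Label) :=
  {S ∈ V.powerset | Indep labelGraph S ∧ #S = k}

theorem mem_indepSubsets {k : ℕ} :
    S ∈ indepSubsets V k ↔ S ⊆ V ∧ Indep labelGraph S ∧ #S = k := by
  classical
  simp [indepSubsets]

/-- If `V` contains one of the four chains at a position, it contains all of them. -/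
def IsChainClosed (V : Finset Label) : Prop :=
  ∀ m n κ κ', 0 < n → HasChain m n κ V V → HasChain m n κ' V V

theorem moveFork_mem {k l : ℕ} (hV : IsChainClosed V) {x : ℤ × ℕ × Bool}
    {p : Finset Label × Finset Label} (hp : p ∈ indepSubsets V k ×ˢ indepSubsets V l)
    (hx : HasFork x p) (κ : Bool × Bool) :
    moveFork x κ p ∈ indepSubsets V k ×ˢ indepSubsets V l := by
  have key (m : ℤ) (n : ℕ) (κ' : Bool × Bool) (k l : ℕ) (p : Finset Label × Finset Label)
      (h : IsFork m n κ' p.1 p.2) (hp : p ∈ indepSubsets V k ×ˢ indepSubsets V l) :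
      replaceChain m n κ p ∈ indepSubsets V k ×ˢ indepSubsets V l := by
    rw [mem_product, mem_indepSubsets, mem_indepSubsets] at hp ⊢
    obtain ⟨⟨hSV, hS, rfl⟩, hTV, hT, rfl⟩ := hp
    have hch : HasChain m n κ V V := hV m n κ' κ h.pos
      ⟨fun v hv => hSV (h.hasChain.1 v hv), fun v hv => hTV (h.hasChain.2 v hv)⟩
    refine ⟨⟨fun v hv => ?_, indep_replace_center hS, h.card_fst⟩,
      fun v hv => ?_, indep_replace_leaf h.pos hT, h.card_snd⟩
    · rw [mem_replaceChain_fst] at hv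
      exact hv.elim (fun hv => hSV hv.1) (hch.1 v)
    · rw [mem_replaceChain_snd] at hv
      exact hv.elim (fun hv => hTV hv.1) (hch.2 v)
  obtain ⟨m, n, b⟩ := x
  obtain ⟨κ', hx⟩ := hx
  cases b
  · exact key m n κ' k l p hx hp
  · rw [mem_product, and_comm] at hp
    have := key m n κ' l k p.swap hx (mem_product.2 hp)
    rw [mem_product, and_comm] at this
    exact mem_product.2 this

theorem moveFork_sum {A : Type*} [Ring A] {h : Label → A} (hF : IsFFDFamily h)
    {x : ℤ × ℕ × Bool} {p : Finset Label × Finset Label} (hS : Indep labelGraph p.1)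
    (hT : Indep labelGraph p.2) (hx : HasFork x p) :
    ∑ κ, monomial h (moveFork x κ p).1 * monomial h (moveFork x κ p).2 = 0 ∧
      ∑ κ, monomial h (moveFork x κ p).2 * monomial h (moveFork x κ p).1 = 0 := by
  obtain ⟨m, n, b⟩ := x
  obtain ⟨κ', hx⟩ := hx
  cases b
  · exact hF.sum_replaceChain hx.pos hS hT
  · exact (hF.sum_replaceChain hx.pos hT hS).symm

/-- Exchanging two independent sets on the balanced components creates no forks, as the leaf zone of
a fork meets only one component. -/
theorem IsFork.of_exchange {P : Label → Prop} [DecidablePred P]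
    (hP : ∀ u v, component labelGraph (S ∪ T) u = component labelGraph (S ∪ T) v → (P u ↔ P v))
    (h : IsFork m n κ (exchange P S T) (exchange P T S)) :
    IsFork m n κ S T ∨ IsFork m n κ T S := by
  have hU : exchange P S T ∪ exchange P T S = S ∪ T := exchange_union_exchange
  have key (v : Label) (hv : v ∈ S ∪ T) (hz : LeafZone m n v) : P v ↔ P (forkVertex m n κ.1) :=
    hP _ _ (h.hasChain.component_eq h.pos (hU ▸ subset_union_left) (hU ▸ subset_union_right) hv hz)
  have hmem (X Y : Finset Label) (hXY : X ∪ Y = S ∪ T) (v : Label) (hz : LeafZone m n v) :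
      v ∈ exchange P X Y ↔ if P (forkVertex m n κ.1) then v ∈ Y else v ∈ X := by
    rw [mem_exchange]
    have := key v
    rw [← hXY, mem_union] at this
    split_ifs <;> tauto
  have h1 (v : Label) (hz : LeafZone m n v) := hmem S T rfl v hz
  have h2 (v : Label) (hz : LeafZone m n v) := hmem T S (union_comm _ _) v hz
  by_cases hc : P (forkVertex m n κ.1)
  · refine Or.inr ⟨h.pos, fun v hv => ?_, fun v hv => ?_⟩
    · rw [← h.center v hv, h1 v (leafZone_of_centerZone hv), if_pos hc]
    · rw [← h.leaf v hv, h2 v hv, if_pos hc]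
  · refine Or.inl ⟨h.pos, fun v hv => ?_, fun v hv => ?_⟩
    · rw [← h.center v hv, h1 v (leafZone_of_centerZone hv), if_neg hc]
    · rw [← h.leaf v hv, h2 v hv, if_neg hc]

/-- Neither of the two sets contains the centres and the other one the leaves of a fork. -/
def IsForkFree (p : Finset Label × Finset Label) : Prop :=
  ∀ m n κ, ¬ IsFork m n κ p.1 p.2 ∧ ¬ IsFork m n κ p.2 p.1

open Classical in
/-- Exchange the two sets on their balanced components. -/
noncomputable def exchangeBalanced (p : Finset Label × Finset Label) :
    Finset Label × Finset Label :=
  (exchange (IsBalanced labelGraph (p.1 ∪ p.2) p.1 p.2) p.1 p.2,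
    exchange (IsBalanced labelGraph (p.1 ∪ p.2) p.1 p.2) p.2 p.1)

theorem exchangeBalanced_exchangeBalanced (p : Finset Label × Finset Label) :
    exchangeBalanced (exchangeBalanced p) = p := by
  classical
  obtain ⟨S, T⟩ := p
  simp only [exchangeBalanced, exchange_union_exchange]
  refine Prod.ext (ext fun v => ?_) (ext fun v => ?_) <;>
    simp only [mem_exchange, isBalanced_exchange] <;> tauto

theorem exchangeBalanced_mem {k l : ℕ} {p : Finset Label × Finset Label}
    (hp : p ∈ indepSubsets V k ×ˢ indepSubsets V l) :
    exchangeBalanced p ∈ indepSubsets V k ×ˢ indepSubsets V l := by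
  classical
  obtain ⟨S, T⟩ := p
  rw [mem_product, mem_indepSubsets, mem_indepSubsets] at hp ⊢
  obtain ⟨⟨hSV, hS, rfl⟩, hTV, hT, rfl⟩ := hp
  have hsub : (exchangeBalanced (S, T)).1 ∪ (exchangeBalanced (S, T)).2 = S ∪ T :=
    exchange_union_exchange
  have hV : S ∪ T ⊆ V := union_subset hSV hTV
  refine ⟨⟨(hsub ▸ subset_union_left).trans hV, ?_, ?_⟩,
    (hsub ▸ subset_union_right).trans hV, ?_, ?_⟩
  · exact indep_exchange hS hT fun u hu v hv huv => isBalanced_iff_of_adj hu hv huv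
  · exact card_exchange card_balanced
  · refine indep_exchange hT hS fun u hu v hv huv => ?_
    rw [union_comm] at hu hv
    exact isBalanced_iff_of_adj hu hv huv
  · exact card_exchange card_balanced.symm

theorem IsForkFree.exchangeBalanced {p : Finset Label × Finset Label} (h : IsForkFree p) :
    IsForkFree (exchangeBalanced p) := by
  classical
  obtain ⟨S, T⟩ := p
  refine fun m n κ => ⟨fun hf => ?_, fun hf => ?_⟩
  · exact (IsFork.of_exchange (fun u v huv => isBalanced_congr huv) hf).elim
      (h m n κ).1 (h m n κ).2
  · refine (IsFork.of_exchange (fun u v huv => ?_) hf).elim (h m n κ).2 (h m n κ).1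
    rw [union_comm] at huv
    exact isBalanced_congr huv

theorem IsForkFree.monomial_exchangeBalanced {A : Type*} [Ring A] {h : Label → A}
    (hG : IsFrustratedBy labelGraph h) {p : Finset Label × Finset Label} (hp : IsForkFree p)
    (hS : Indep labelGraph p.1) (hT : Indep labelGraph p.2) :
    monomial h (ExtFFD.exchangeBalanced p).1 * monomial h (ExtFFD.exchangeBalanced p).2 =
      monomial h p.2 * monomial h p.1 := by
  classical
  refine hG.monomial_exchange_balanced hS hT (fun c => ?_) fun c => ?_
  · convert sum_degree_component_le hS hT (fun m n κ => (hp m n κ).1) subset_union_left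
      subset_union_right c
  · convert sum_degree_component_le hT hS (fun m n κ => (hp m n κ).2) subset_union_right
      subset_union_left c

/-- The sum of the monomials of the independent subsets of `V` with `k` elements. -/
noncomputable def labelCharge {A : Type*} [Ring A] (h : Label → A) (V : Finset Label) (k : ℕ) : A :=
  ∑ S ∈ indepSubsets V k, monomial h S

/-- All forks in pairs of subsets of `V` occur at finitely many sites. -/
theorem exists_sites (V : Finset Label) : ∃ X : Finset (ℤ × ℕ × Bool),
    ∀ p : Finset Label × Finset Label, p.1 ⊆ V → p.2 ⊆ V →
      ((∀ x ∈ X, ¬ HasFork x p) ↔ IsForkFree p) := by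
  have key {m : ℤ} {n : ℕ} {κ : Bool × Bool} {S T : Finset Label} (hS : S ⊆ V) (hT : T ⊆ V)
      (h : IsFork m n κ S T) :
      m ∈ (V.image fun v => v.elim (fun j => (j + 1) / 2) (fun k => k - 1)) ∧
        n ∈ range (#V + 1) := by
    -- The leftmost centre, `h_{2m-1}` or `hbar_{2m+3}`, determines `m`.
    have hn := h.pos
    constructor
    · rw [mem_image]
      obtain ⟨_ | _, α⟩ := κ
      · exact ⟨.inl (2 * m - 1), hS (h.hasChain.1 _ (by simp only [IsCenter]; omega)), by simp⟩
      · exact ⟨.inr (m + 1), hS (h.hasChain.1 _ (by simp only [IsCenter]; omega)), by simp⟩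
    · have := h.hasChain.le_card
      have := card_le_card hS
      simp
      omega
  refine ⟨(V.image fun v => v.elim (fun j => (j + 1) / 2) (fun k => k - 1)) ×ˢ
    range (#V + 1) ×ˢ univ, fun p h1 h2 => ⟨fun h m n κ => ⟨fun hf => ?_, fun hf => ?_⟩, ?_⟩⟩
  · refine h (m, n, false) ?_ ⟨κ, hf⟩
    have := key h1 h2 hf
    simp only [mem_product]
    exact ⟨this.1, this.2, mem_univ _⟩
  · refine h (m, n, true) ?_ ⟨κ, hf⟩
    have := key h2 h1 hf
    simp only [mem_product]
    exact ⟨this.1, this.2, mem_univ _⟩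
  · rintro h ⟨m, n, b⟩ - ⟨κ, hf⟩
    cases b
    · exact (h m n κ).1 hf
    · exact (h m n κ).2 hf

/-- In the product of two charges, the pairs with a fork cancel among themselves in either order of
the factors, and on the others `exchangeBalanced` is an involution that reverses the order. -/
theorem IsFFDFamily.commute_labelCharge {A : Type*} [Ring A] {h : Label → A} (hF : IsFFDFamily h)
    (hV : IsChainClosed V) (k l : ℕ) : Commute (labelCharge h V k) (labelCharge h V l) := by
  classical
  obtain ⟨X, hX⟩ := exists_sites V
  set Q := indepSubsets V k ×ˢ indepSubsets V l with hQ
  have hmem {p : Finset Label × Finset Label} (hp : p ∈ Q) : p.1 ⊆ V ∧ p.2 ⊆ V ∧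
      Indep labelGraph p.1 ∧ Indep labelGraph p.2 := by
    rw [hQ, mem_product, mem_indepSubsets, mem_indepSubsets] at hp
    exact ⟨hp.1.1, hp.2.1, hp.1.2.1, hp.2.2.1⟩
  have hfree : ({p ∈ Q | ∀ x ∈ X, ¬ HasFork x p} : Finset _) = {p ∈ Q | IsForkFree p} :=
    filter_congr fun p hp => hX p (hmem hp).1 (hmem hp).2.1
  have h1 := sum_without_forks Q (fun p => monomial h p.1 * monomial h p.2) X
    (fun x _ p hp hx κ => moveFork_mem hV hp hx κ)
    fun x _ p hp hx => (moveFork_sum hF (hmem hp).2.2.1 (hmem hp).2.2.2 hx).1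
  have h2 := sum_without_forks Q (fun p => monomial h p.2 * monomial h p.1) X
    (fun x _ p hp hx κ => moveFork_mem hV hp hx κ)
    fun x _ p hp hx => (moveFork_sum hF (hmem hp).2.2.1 (hmem hp).2.2.2 hx).2
  rw [hfree] at h1 h2
  change labelCharge h V k * labelCharge h V l = labelCharge h V l * labelCharge h V k
  rw [labelCharge, labelCharge, sum_mul_sum, sum_mul_sum, sum_comm (s := indepSubsets V l),
    ← sum_product', ← sum_product', ← hQ, ← h1, ← h2]
  have hmaps : ∀ p ∈ ({p ∈ Q | IsForkFree p} : Finset _),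
      exchangeBalanced p ∈ ({p ∈ Q | IsForkFree p} : Finset _) := by
    intro p hp
    rw [mem_filter] at hp ⊢
    exact ⟨exchangeBalanced_mem hp.1, hp.2.exchangeBalanced⟩
  refine (sum_nbij' exchangeBalanced exchangeBalanced hmaps hmaps
    (fun p _ => exchangeBalanced_exchangeBalanced p)
    (fun p _ => exchangeBalanced_exchangeBalanced p) fun p hp => ?_).symm
  rw [mem_filter] at hp
  exact (hp.2.monomial_exchangeBalanced hF.frustrated (hmem hp.1).2.2.1 (hmem hp.1).2.2.2).symm

end ExtFFD

namespace ExtFFD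

open Finset

variable {M : ℕ} {b : Vertex M → ℂ} {A : Type*} [Ring A] [Algebra ℂ A]

/-! ### The extended FFD algebra and its charges in terms of labels -/

/-- The label of a vertex. -/
def toLabel (M : ℕ) : Vertex M ↪ Label where
  toFun := Sum.map (fun i => (i : ℤ) + 1) fun i => (i : ℤ)
  inj' := by
    rintro (i | i) (j | j) h <;> simp at h ⊢ <;> omega

theorem toLabel_inl (i : Fin M) : toLabel M (.inl i) = .inl ((i : ℤ) + 1) := rfl

theorem toLabel_inr (i : Fin (M / 2 + 1)) : toLabel M (.inr i) = .inr (i : ℤ) := rfl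

theorem adj_toLabel {u v : Vertex M} :
    labelGraph.Adj (toLabel M u) (toLabel M v) ↔ (frustrationGraph M).Adj u v := by
  rcases u with i | i <;> rcases v with j | j
  · rw [toLabel_inl, toLabel_inl, adj_inl_inl]
    change _ ↔ (i : ℤ) ≠ j ∧ |(i : ℤ) - j| ≤ 2
    rw [abs_le]
    omega
  · exact Iff.rfl
  · exact Iff.rfl
  · rw [toLabel_inr, toLabel_inr, adj_inr_inr]
    change _ ↔ |(2 * (i : ℤ) + 1) - (2 * (j : ℤ) + 1)| = 2
    rw [abs_eq (by norm_num)]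
    omega

/-- The labels of the vertices of the frustration graph with parameter `M`. -/
def labels (M : ℕ) : Finset Label := univ.map (toLabel M)

theorem inl_mem_labels {j : ℤ} : .inl j ∈ labels M ↔ 1 ≤ j ∧ j ≤ M := by
  simp only [labels, mem_map, mem_univ, true_and, Sum.exists, toLabel_inl, toLabel_inr,
    Sum.inl.injEq, reduceCtorEq, exists_false, or_false]
  constructor
  · rintro ⟨i, rfl⟩
    omega
  · intro h
    exact ⟨⟨(j - 1).toNat, by omega⟩, by simp only; omega⟩

theorem inr_mem_labels {k : ℤ} : .inr k ∈ labels M ↔ 0 ≤ k ∧ k ≤ M / 2 := by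
  simp only [labels, mem_map, mem_univ, true_and, Sum.exists, toLabel_inl, toLabel_inr,
    Sum.inr.injEq, reduceCtorEq, exists_false, false_or]
  constructor
  · rintro ⟨i, rfl⟩
    omega
  · intro h
    exact ⟨⟨k.toNat, by omega⟩, by simp only; omega⟩

/-- The labels of any chain at the position `(m, n)` are in range if and only if `2 ≤ m` and
`m + 2 n ≤ M / 2`. -/
theorem isChainClosed_labels (M : ℕ) : IsChainClosed (labels M) := by
  intro m n κ κ' hn h
  have hm : 2 ≤ m ∧ m + 2 * n ≤ M / 2 := by
    have h1 (j : ℤ) (hj : IsLeaf m n κ (.inl j)) := inl_mem_labels.1 (h.2 _ hj)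
    have h2 (k : ℤ) (hk : IsLeaf m n κ (.inr k)) := inr_mem_labels.1 (h.2 _ hk)
    obtain ⟨_ | _, _ | _⟩ := κ <;> simp only [IsLeaf] at h1 h2
    · have := h1 (2 * m - 3)
      have := h2 (m + 2 * n)
      omega
    · have := h1 (2 * m - 2)
      have := h2 (m + 2 * n)
      omega
    · have := h1 (2 * m - 3)
      have := h1 (2 * m + 4 * n)
      omega
    · have := h1 (2 * m - 3)
      have := h2 (m + 2 * n)
      omega
  constructor <;> rintro (j | k) hv
  · obtain ⟨_ | _, _ | _⟩ := κ' <;> simp only [IsCenter] at hv <;> rw [inl_mem_labels] <;> omega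
  · obtain ⟨_ | _, _ | _⟩ := κ' <;> simp only [IsCenter] at hv <;> rw [inr_mem_labels] <;> omega
  · obtain ⟨_ | _, _ | _⟩ := κ' <;> simp only [IsLeaf] at hv <;> rw [inl_mem_labels] <;> omega
  · obtain ⟨_ | _, _ | _⟩ := κ' <;> simp only [IsLeaf] at hv <;> rw [inr_mem_labels] <;> omega

/-- The images of the generators in a representation, extended by zero to all labels. -/
noncomputable def labelGen (ρ : ExtendedFFDAlgebra M b →ₐ[ℂ] A) : Label → A :=
  Function.extend (toLabel M) (fun v => ρ (gen M b v)) 0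

variable (ρ : ExtendedFFDAlgebra M b →ₐ[ℂ] A)

theorem labelGen_toLabel (v : Vertex M) : labelGen ρ (toLabel M v) = ρ (gen M b v) :=
  (toLabel M).injective.extend_apply _ _ v

theorem labelGen_eq_zero {v : Label} (hv : v ∉ labels M) : labelGen ρ v = 0 :=
  Function.extend_apply' _ _ _ fun ⟨w, hw⟩ => hv (hw ▸ mem_map_of_mem _ (mem_univ w))

theorem labelGen_inl (j : ℕ) :
    labelGen ρ (.inl j) = ρ (RingQuot.mkAlgHom ℂ (Rel M b) (freeH M j)) := by
  unfold freeH
  split_ifs with hj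
  · rw [← gen, ← labelGen_toLabel, toLabel_inl]
    congr 2
    simp only
    omega
  · rw [map_zero, map_zero, labelGen_eq_zero ρ (by rw [inl_mem_labels]; omega)]

theorem labelGen_inr (k : ℕ) :
    labelGen ρ (.inr k) = ρ (RingQuot.mkAlgHom ℂ (Rel M b) (freeHbar M k)) := by
  unfold freeHbar
  split_ifs with hk
  · rw [← gen, ← labelGen_toLabel, toLabel_inr]
  · rw [map_zero, map_zero, labelGen_eq_zero ρ (by rw [inr_mem_labels]; omega)]

theorem hingeElement_labelGen {m : ℕ} (hm : 2 ≤ m) :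
    hingeElement (labelGen ρ) m = ρ (RingQuot.mkAlgHom ℂ (Rel M b) (freeA M m)) := by
  rw [freeA, hingeElement, show 2 * (m : ℤ) - 3 = (2 * m - 3 : ℕ) by omega,
    show 2 * (m : ℤ) - 2 = (2 * m - 2 : ℕ) by omega, show 2 * (m : ℤ) = (2 * m : ℕ) by omega]
  simp only [labelGen_inl, labelGen_inr, map_add, map_mul]

theorem linkElement_labelGen {m : ℕ} (hm : 2 ≤ m) :
    linkElement (labelGen ρ) m = ρ (RingQuot.mkAlgHom ℂ (Rel M b) (freeC M m)) := by
  rw [freeC, linkElement, show 2 * (m : ℤ) - 3 = (2 * m - 3 : ℕ) by omega,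
    show (m : ℤ) + 1 = (m + 1 : ℕ) by omega]
  simp only [labelGen_inl, labelGen_inr, map_mul]

theorem isFrustratedBy_labelGen : IsFrustratedBy labelGraph (labelGen ρ) where
  commute {u v} huv := by
    by_cases hu : u ∈ labels M
    · by_cases hv : v ∈ labels M
      · obtain ⟨u, -, rfl⟩ := mem_map.1 hu
        obtain ⟨v, -, rfl⟩ := mem_map.1 hv
        rw [labelGen_toLabel, labelGen_toLabel]
        exact (gen_commute b (mt adj_toLabel.2 huv)).map ρ
      · rw [labelGen_eq_zero ρ hv]
        exact Commute.zero_right _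
    · rw [labelGen_eq_zero ρ hu]
      exact Commute.zero_left _
  anticommute {u v} huv := by
    by_cases hu : u ∈ labels M
    · by_cases hv : v ∈ labels M
      · obtain ⟨u, -, rfl⟩ := mem_map.1 hu
        obtain ⟨v, -, rfl⟩ := mem_map.1 hv
        have h := RingQuot.mkAlgHom_rel ℂ (Rel.anticomm (b := b) u v (adj_toLabel.1 huv))
        simp only [map_mul, map_neg] at h
        rw [labelGen_toLabel, labelGen_toLabel, gen, gen, ← map_mul, h, map_neg, map_mul]
      · simp [labelGen_eq_zero ρ hv]
    · simp [labelGen_eq_zero ρ hu]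

/-- For `m` out of range, every product in the relation `A_{2m-1} C_{2m+2} = C_{2m} A_{2m+3}`
contains a generator that does not exist, so the relation holds for the extension by zero. -/
theorem isFFDFamily_labelGen : IsFFDFamily (labelGen ρ) where
  frustrated := isFrustratedBy_labelGen ρ
  hinge_mul_link m := by
    by_cases hm : 1 < m ∧ m + 1 < M / 2
    · lift m to ℕ using by omega
      have h := congrArg ρ (RingQuot.mkAlgHom_rel ℂ
        (Rel.ac (b := b) m (by omega) (by omega)))
      simp only [map_mul] at h
      rw [show (m : ℤ) + 1 = (m + 1 : ℕ) by omega, show (m : ℤ) + 2 = (m + 2 : ℕ) by omega,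
        hingeElement_labelGen ρ (by omega), linkElement_labelGen ρ (by omega),
        linkElement_labelGen ρ (by omega), hingeElement_labelGen ρ (by omega), h]
    · have hz (j : ℤ) (hj : ¬ (1 ≤ j ∧ j ≤ M)) : labelGen ρ (.inl j) = 0 :=
        labelGen_eq_zero ρ (by rwa [inl_mem_labels])
      have hz' (k : ℤ) (hk : ¬ (0 ≤ k ∧ k ≤ M / 2)) : labelGen ρ (.inr k) = 0 :=
        labelGen_eq_zero ρ (by rwa [inr_mem_labels])
      unfold hingeElement linkElement
      obtain hm | hm : m ≤ 1 ∨ (M / 2 : ℕ) < m + 2 := by omega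
      · rw [hz (2 * m - 3) (by omega), hz (2 * m - 2) (by omega)]
        simp
      · rw [hz' (m + 1 + 1) (by omega), hz' (m + 2) (by omega), hz (2 * (m + 2)) (by omega)]
        simp

theorem charge_eq_labelCharge (k : ℕ) : charge ρ k = labelCharge (labelGen ρ) (labels M) k := by
  have hind {S : Finset (Vertex M)} : Indep labelGraph (S.map (toLabel M)) ↔
      (frustrationGraph M).IsIndepSet (S : Set (Vertex M)) := by
    simp only [Indep, forall_mem_map, adj_toLabel]
    exact ⟨fun h u hu v hv _ => h u hu v hv, fun h u hu v hv huv => h hu hv huv.ne huv⟩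
  refine sum_bij (fun S _ => S.1.map (toLabel M)) ?_ ?_ ?_ ?_
  · intro S _
    have hS := SimpleGraph.mem_indepSetFinset_iff.1 S.2
    rw [mem_indepSubsets, card_map]
    exact ⟨map_subset_map.2 (subset_univ _), hind.2 hS.isIndepSet, hS.card_eq⟩
  · exact fun S _ T _ h => Subtype.ext (map_injective _ h)
  · intro S hS
    rw [mem_indepSubsets] at hS
    obtain ⟨T, -, rfl⟩ := subset_map_iff.1 hS.1
    rw [hind, card_map] at hS
    exact ⟨⟨T, SimpleGraph.mem_indepSetFinset_iff.2 ⟨hS.2.1, hS.2.2⟩⟩, mem_attach _ _, rfl⟩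
  · intro S _
    have hS := (SimpleGraph.mem_indepSetFinset_iff.1 S.2).isIndepSet
    rw [monomial_eq ((hind.2 hS).pairwise (isFrustratedBy_labelGen ρ))]
    simp only [noncommProd, map_val, Multiset.map_map, Function.comp_def, labelGen_toLabel]

end ExtFFD

/-- The charges `Q_M^{(k)}`, `1 ≤ k ≤ S_M` with `S_M` the independence number of the frustration
graph, commute with one another in every representation `ρ` of the extended FFD algebra (for
`ρ = AlgHom.id` this is the statement in the algebra itself). -/
theorem mainTheorem2 {A : Type*} [Ring A] [Algebra ℂ A] (M : ℕ) (b : ExtFFD.Vertex M → ℂ)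
    (ρ : ExtFFD.ExtendedFFDAlgebra M b →ₐ[ℂ] A) (k l : ℕ)
    (hk : k ∈ Finset.Icc 1 (ExtFFD.frustrationGraph M).indepNum)
    (hl : l ∈ Finset.Icc 1 (ExtFFD.frustrationGraph M).indepNum) :
    ⁅ExtFFD.charge ρ k, ExtFFD.charge ρ l⁆ = 0 := by
  rw [ExtFFD.charge_eq_labelCharge, ExtFFD.charge_eq_labelCharge]
  exact ((ExtFFD.isFFDFamily_labelGen ρ).commute_labelCharge
    (ExtFFD.isChainClosed_labels M) k l).lie_eq
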